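/- Let $d\ge 1$, $\alpha,\beta,L,C_Z>0$, and let $\lfloor\alpha\rfloor$ denote the largest non-negative integer strictly smaller than $\alpha$. Write $|a|=a_1+\dots+a_d$, $p_{\min}=\min_k p_k$, $p^{\mathbf 1}=p_1\cdots p_d$, and $r_{n,p}=\log(np^{\mathbf 1})/(np^{\mathbf 1})$. **Classes.** $\mathcal H(\alpha,L)$ is the set of functions $f$ on $[0,1]^d$ that are $\lfloor\alpha\rfloor$ times continuously differentiable (up to the boundary) with $$\|f\|_{\mathcal H,\alpha}=\max_{|k|\le\lfloor\alpha\rfloor}\sup_{x}|\partial^k f(x)|+\max_{|k|=\lfloor\alpha\rfloor}\sup_{x\ne y}\frac{|\partial^kf(x)-\partial^kf(y)|}{\|x-y\|_\infty^{\alpha-\lfloor\alpha\rfloor}}\le L .$$ $\mathcal P(\beta,C_Z)$ is the set of processes $Z$ on $[0,1]^d$ with paths differentiable up to order $\lfloor\beta\rfloor$ for which there is a random variable $M$ with $\|Z\|_{\mathcal H,\beta}\le M$ a.s. and $\mathbb E[M^2]\le C_Z$. **Model.** One observes $Y_{i,j}=\mu(x_j)+Z_i(x_j)+\varepsilon_{i,j}$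 for $1\le i\le n$ and $j\in\prod_k\{1,\dots,p_k\}$, where $x_j=(x_{1,j_1},\dots,x_{d,j_d})\in[0,1]^d$ are fixed, $x_{k,1}<\dots<x_{k,p_k}$; $\mu\in\mathcal H(\alpha,L)$; $Z_1,\dots,Z_n$ are i.i.d. centred processes in $\mathcal P(\beta,C_Z)$; the $\varepsilon_{i,j}$ are centred, independent, independent of $(Z_1,\dots,Z_n)$, with $\sigma_{i,j}^2=\mathbb E[\varepsilon_{i,j}^2]\le\sigma^2$, and sub-Gaussian with variance proxy $\zeta^2\sigma_{i,j}^2$, i.e. $\mathbb E[e^{\lambda\varepsilon_{i,j}}]\le e^{\lambda^2\zeta^2\sigma_{i,j}^2/2}$ for all $\lambda\in\mathbb R$. **Design.** For all $x\in[0,1]^d$ and $h\ge 1/p_{\min}$, at most $C_d\,h^d\,p^{\mathbf 1}$ of the design points lie in $\prod_k[x_k-h,x_k+h]$. **Estimator.** Let $s\in\mathbb N_0^d$ with $|s|\le\lfloor\alpha\rfloor$ and $\hat\mu^{(s)}_{n,p,h}(x)=\sum_j w_j(x;h)\,\frac1n\sum_{i=1}^nY_{i,j}$ with deterministic weights such that,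 for constants $c,h_0,C_1,C_2>0$, all $h\in(c/p_{\min},h_0]$ and all $x,y\in[0,1]^d$: (M1) $\sum_j(x_j-x)^r w_j(x;h)=\delta_{r,s}\,s!$ for all $r\in\mathbb N_0^d$ with $|r|\le\lfloor\alpha\rfloor$; (M2) $w_j(x;h)=0$ if $\|x-x_j\|_\infty>h$; (M3) $|w_j(x;h)|\le C_1/(p^{\mathbf 1}h^{d+|s|})$; (M4) $|w_j(x;h)-w_j(y;h)|\le \frac{C_2}{p^{\mathbf 1}h^{d+|s|}}\min\big(\|x-y\|_\infty/h,\,1\big)$. Below, $h^\star\simeq A$ means $aA\le h^\star\le bA$ for fixed constants $0<a\le b$, and $h^\star$ is required to lie in $(c/p_{\min},h_0]$. The suprema are over $\mu\in\mathcal H(\alpha,L)$ and over all $Z$ and $\varepsilon$ as in the model, and $\mathcal O$ holds uniformly for all sufficiently large $n$ and $p_{\min}$, with constants and thresholds that depend only on $d,\alpha,\beta,\beta_1,L,C_Z,s,C_d,\sigma,\zeta,c,h_0,C_1,C_2,a,b$. (i) (Rough processes) If $\beta\le|s|$, then for every fixed $0<\beta_1<\beta$ and $$h^\star\simeq\max\Big\{\tfrac1{p_{\min}},\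 r_{n,p}^{\frac1{2\alpha+d}},\ n^{-\frac1{2(\alpha-\beta_1)}}\Big\},$$ $$\sup\ \mathbb E\Big[\sup_{x\in[0,1]^d}\big|\hat\mu^{(s)}_{n,p,h^\star}(x)-\partial^s\mu(x)\big|\Big]=\mathcal O\Big(\max\Big\{p_{\min}^{-(\alpha-|s|)},\ r_{n,p}^{\frac{\alpha-|s|}{2\alpha+d}},\ n^{-\frac{\alpha-|s|}{2(\alpha-\beta_1)}}\Big\}\Big).$$ (ii) (Smooth processes) If $\beta>|s|$, then for $$h^\star\simeq\max\Big\{\tfrac1{p_{\min}},\ r_{n,p}^{\frac1{2\alpha+d}}\Big\},$$ $$\sup\ \mathbb E\Big[\sup_{x\in[0,1]^d}\big|\hat\mu^{(s)}_{n,p,h^\star}(x)-\partial^s\mu(x)\big|\Big]=\mathcal O\Big(\max\Big\{p_{\min}^{-(\alpha-|s|)},\ r_{n,p}^{\frac{\alpha-|s|}{2\alpha+d}},\ n^{-\frac12}\Big\}\Big).$$ -/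

import Mathlib

open MeasureTheory ProbabilityTheory
open scoped BigOperators ENNReal

/-- The closed unit cube `[0,1]^d`; `Fin d → ℝ` carries the sup-norm. -/
def unitCube (d : ℕ) : Set (Fin d → ℝ) := Set.Icc 0 1

/-- The largest natural number that is strictly smaller than `α` (for `α > 0`). -/
noncomputable def strictFloor (α : ℝ) : ℕ := ⌈α⌉₊ - 1

theorem strictFloor_isGreatest {α : ℝ} (hα : 0 < α) :
    IsGreatest {k : ℕ | (k : ℝ) < α} (strictFloor α) := by
  have h1 : 0 < ⌈α⌉₊ := Nat.ceil_pos.mpr hα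
  constructor
  · show ((strictFloor α : ℕ) : ℝ) < α
    rw [← Nat.lt_ceil]
    unfold strictFloor
    omega
  · intro k hk
    have h2 : k < ⌈α⌉₊ := Nat.lt_ceil.mpr hk
    unfold strictFloor
    omega

/-- The partial derivative in direction `i` of a function on the closed cube. On the boundary this is
the derivative within the cube, that is, the continuous extension for functions that are `C^1` up to
the boundary. Only the values of `f` on the cube matter. -/
noncomputable def cubePartial {d : ℕ} (i : Fin d) (f : (Fin d → ℝ) → ℝ) : (Fin d → ℝ) → ℝ :=
  fun x => fderivWithin ℝ f (unitCube d) x (Pi.single i 1)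

/-- The partial derivative `∂^k = ∂_1^{k_1} ⋯ ∂_d^{k_d}` on the closed cube. -/
noncomputable def multiPartial {d : ℕ} (k : Fin d → ℕ) (f : (Fin d → ℝ) → ℝ) : (Fin d → ℝ) → ℝ :=
  (List.finRange d).foldr (fun i g => (cubePartial i)^[k i] g) f

/-- The Hölder norm of index `α` on `[0,1]^d`, with values in `[0,∞]`. -/
noncomputable def holderNorm {d : ℕ} (α : ℝ) (f : (Fin d → ℝ) → ℝ) : ℝ≥0∞ :=
  (⨆ (k : Fin d → ℕ) (_ : ∑ i, k i ≤ strictFloor α), ⨆ x ∈ unitCube d,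
      ENNReal.ofReal |multiPartial k f x|) +
  (⨆ (k : Fin d → ℕ) (_ : ∑ i, k i = strictFloor α), ⨆ x ∈ unitCube d, ⨆ y ∈ unitCube d,
      ⨆ (_ : x ≠ y), ENNReal.ofReal
        (|multiPartial k f x - multiPartial k f y| / ‖x - y‖ ^ (α - (strictFloor α : ℝ))))

/-- The Hölder class `H(α, L)` on `[0,1]^d`. -/
def HolderClass {d : ℕ} (α L : ℝ) (f : (Fin d → ℝ) → ℝ) : Prop :=
  ContDiffOn ℝ (strictFloor α : ℕ) f (unitCube d) ∧ holderNorm α f ≤ ENNReal.ofReal L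

/-- The class `P(β, C_Z)` of processes on `[0,1]^d`: almost surely the path is `⌊β⌋` times
continuously differentiable with Hölder norm at most `M`, where `E[M²] ≤ C_Z`. -/
def ProcessClass {d : ℕ} {Ω : Type*} [MeasurableSpace Ω] (P : Measure Ω) (β CZ : ℝ)
    (Z : (Fin d → ℝ) → Ω → ℝ) : Prop :=
  (∀ x ∈ unitCube d, Measurable (Z x)) ∧
  ∃ M : Ω → ℝ, MemLp M 2 P ∧ ∫ ω, (M ω) ^ 2 ∂P ≤ CZ ∧
    ∀ᵐ ω ∂P, HolderClass β (M ω) (fun x => Z x ω)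

/-- The multi-indices `j` with `1 ≤ j ≤ p` (counted from zero). -/
abbrev Grid {d : ℕ} (p : Fin d → ℕ) : Type := ∀ k : Fin d, Fin (p k)

/-- `p_min = min_k p_k`. -/
noncomputable def pMin {d : ℕ} (p : Fin d → ℕ) : ℕ := ⨅ k, p k

/-- `p^1 = p_1 ⋯ p_d`, the number of design points. -/
def pProd {d : ℕ} (p : Fin d → ℕ) : ℕ := ∏ k, p k

/-- The design point `x_j = (x_{1,j_1}, …, x_{d,j_d})`. -/
def designPoint {d : ℕ} {p : Fin d → ℕ} (t : ∀ k : Fin d, Fin (p k) → ℝ) (j : Grid p) :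
    Fin d → ℝ :=
  fun k => t k (j k)

/-- A regular Cartesian product design in `[0,1]^d` with constant `Cd`: a window of half-width
`h ≥ 1 / p_min` contains at most `Cd * h^d * p^1` design points. -/
structure RegularDesign {d : ℕ} (Cd : ℝ) (p : Fin d → ℕ) (t : ∀ k : Fin d, Fin (p k) → ℝ) :
    Prop where
  mem_unit : ∀ k l, t k l ∈ Set.Icc (0 : ℝ) 1
  strictMono : ∀ k, StrictMono (t k)
  card_le : ∀ x ∈ unitCube d, ∀ h : ℝ, 1 / (pMin p : ℝ) ≤ h →
    (Nat.card {j : Grid p // ∀ k, x k - h ≤ designPoint t j k ∧ designPoint t j k ≤ x k + h} : ℝ)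
      ≤ Cd * h ^ d * (pProd p : ℝ)

/-- The conditions on the weights `w h x j` of a linear estimator of the derivative of order `s`,
for all bandwidths `h ∈ (c / p_min, h₀]`, with polynomial reproduction up to the degree `m`. -/
structure WeightCondition {d : ℕ} (s : Fin d → ℕ) (m : ℕ) (c h₀ C₁ C₂ : ℝ) (p : Fin d → ℕ)
    (t : ∀ k : Fin d, Fin (p k) → ℝ) (w : ℝ → (Fin d → ℝ) → Grid p → ℝ) : Prop where
  reproduce : ∀ h ∈ Set.Ioc (c / (pMin p : ℝ)) h₀, ∀ x ∈ unitCube d,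
    ∀ r : Fin d → ℕ, ∑ k, r k ≤ m →
      ∑ j : Grid p, (∏ k, (designPoint t j k - x k) ^ (r k)) * w h x j =
        if r = s then ∏ k, ((s k).factorial : ℝ) else 0
  localize : ∀ h ∈ Set.Ioc (c / (pMin p : ℝ)) h₀, ∀ x ∈ unitCube d, ∀ j : Grid p,
    h < ‖x - designPoint t j‖ → w h x j = 0
  bounded : ∀ h ∈ Set.Ioc (c / (pMin p : ℝ)) h₀, ∀ x ∈ unitCube d, ∀ j : Grid p,
    |w h x j| ≤ C₁ / ((pProd p : ℝ) * h ^ (d + ∑ k, s k))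
  lipschitz : ∀ h ∈ Set.Ioc (c / (pMin p : ℝ)) h₀, ∀ x ∈ unitCube d, ∀ y ∈ unitCube d,
    ∀ j : Grid p,
      |w h x j - w h y j| ≤ C₂ / ((pProd p : ℝ) * h ^ (d + ∑ k, s k)) * min (‖x - y‖ / h) 1

/-- The random inputs of the model: `Z_1, …, Z_n` are i.i.d. centred processes in `P(β, C_Z)`; the
errors are independent, centred, independent of the processes, with variances at most `σ²`, and
sub-Gaussian with variance proxy `ζ² E[ε²]`. -/
structure FunctionalDataModel {d : ℕ} {Ω : Type*} [MeasurableSpace Ω] (P : Measure Ω)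
    (β CZ σ ζ : ℝ) (n : ℕ) (p : Fin d → ℕ)
    (Z : Fin n → (Fin d → ℝ) → Ω → ℝ) (ε : Fin n → Grid p → Ω → ℝ) : Prop where
  process_class : ∀ i, ProcessClass P β CZ (Z i)
  process_centred : ∀ i, ∀ x ∈ unitCube d, ∫ ω, Z i x ω ∂P = 0
  process_indep : iIndepFun (fun i ω (x : unitCube d) => Z i x ω) P
  process_identDistrib : ∀ i i',
    IdentDistrib (fun ω (x : unitCube d) => Z i x ω) (fun ω (x : unitCube d) => Z i' x ω) P P
  error_measurable : ∀ i j, Measurable (ε i j)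
  error_centred : ∀ i j, ∫ ω, ε i j ω ∂P = 0
  error_variance : ∀ i j, ∫ ω, (ε i j ω) ^ 2 ∂P ≤ σ ^ 2
  error_subGaussian : ∀ i j,
    HasSubgaussianMGF (ε i j) (Real.toNNReal (ζ ^ 2 * ∫ ω, (ε i j ω) ^ 2 ∂P)) P
  error_indep : iIndepFun (fun (ij : Fin n × Grid p) => ε ij.1 ij.2) P
  error_indep_process : IndepFun (fun ω (ij : Fin n × Grid p) => ε ij.1 ij.2 ω)
    (fun ω (i : Fin n) (x : unitCube d) => Z i x ω) P

/-- The observation `Y_{i,j} = μ(x_j) + Z_i(x_j) + ε_{i,j}`. -/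
def observation {d n : ℕ} {Ω : Type*} {p : Fin d → ℕ} (t : ∀ k : Fin d, Fin (p k) → ℝ)
    (μ : (Fin d → ℝ) → ℝ) (Z : Fin n → (Fin d → ℝ) → Ω → ℝ) (ε : Fin n → Grid p → Ω → ℝ)
    (i : Fin n) (j : Grid p) (ω : Ω) : ℝ :=
  μ (designPoint t j) + Z i (designPoint t j) ω + ε i j ω

/-- The linear estimator `∑_j w_j(x; h) Ȳ_j`, where `Ȳ_j` is the mean of the `Y_{i,j}` over `i`. -/
noncomputable def linearEstimator {d n : ℕ} {p : Fin d → ℕ} (w : ℝ → (Fin d → ℝ) → Grid p → ℝ)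
    (h : ℝ) (Y : Fin n → Grid p → ℝ) (x : Fin d → ℝ) : ℝ :=
  ∑ j : Grid p, w h x j * ((1 / (n : ℝ)) * ∑ i, Y i j)

/-- The sup-norm risk `E ‖μ̂^{(s)} - ∂^s μ‖_∞`, with values in `[0,∞]`. -/
noncomputable def supRisk {d n : ℕ} {Ω : Type*} [MeasurableSpace Ω] (P : Measure Ω)
    {p : Fin d → ℕ} (s : Fin d → ℕ) (t : ∀ k : Fin d, Fin (p k) → ℝ)
    (w : ℝ → (Fin d → ℝ) → Grid p → ℝ) (h : ℝ)
    (μ : (Fin d → ℝ) → ℝ) (Z : Fin n → (Fin d → ℝ) → Ω → ℝ) (ε : Fin n → Grid p → Ω → ℝ) :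
    ℝ≥0∞ :=
  ∫⁻ ω, ⨆ x ∈ unitCube d, ENNReal.ofReal
    |linearEstimator w h (fun i j => observation t μ Z ε i j ω) x - multiPartial s μ x| ∂P

/-- The quantity `log(n p^1) / (n p^1)`. -/
noncomputable def noiseLevel {d : ℕ} (n : ℕ) (p : Fin d → ℕ) : ℝ :=
  Real.log ((n : ℝ) * (pProd p : ℝ)) / ((n : ℝ) * (pProd p : ℝ))

/-! By linearity the error splits into a bias, the weighted mean of the processes and the weighted
mean of the errors; each is bounded uniformly in `x`. Write `S = |s|`. A window of half-width `h`
holds at most a constant times `h^d p^1` design points, so the absolute weights sum to at most a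
constant times `h^(-S)`.

Bias: the weights reproduce the Taylor polynomial of `μ` at `x`, and the remainder is of order `h^α`
on the window. The bias is therefore of order `h^(α - S)` (`WeightCondition.abs_bias_le`).

Errors: at a fixed `x` the weighted mean is sub-Gaussian with proxy of order `1 / (n p^1 h^(d +
2S))`. A maximal inequality on a grid of polynomial size in `n p^1` costs a factor `√log(n p^1)`,
and the Lipschitz condition on the weights fills the gaps. The condition `h ≥ a r^(1/(2α+d))`, with
`r` the noise level, is exactly what makes this at most a constant times `h^(α - S)`
(`FunctionalDataModel.exists_error_bound`).

Processes: the functional is applied to a random path of Hölder norm `M`. If `β ≤ S`, the weights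
kill polynomials of degree below `S`, so the values are at most of order `M h^(β - S)`, with
increments of order `M h^(β - S) (‖x - y‖/h)^η` for small `η`. If `β > S`, values and increments are
bounded by `M` and `M ‖x - y‖^γ` without any power of `h`. Symmetrization and dyadic chaining
(`exists_chaining_bound`) give an expected supremum of order `h^(β - S - η)/√n`, respectively
`1/√n`. The loss `h^(-η)` is why the rough case is stated with `β₁ < β`; there `h ≥ a
n^(-1/(2(α-β₁)))` turns the bound into `h^(α - S)`.

Inserting the upper bound on `h` into `h^(α - S)` gives the rates. -/

section CubeCalculus

/-! ### Partial derivatives on the closed cube. -/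

variable {d : ℕ}

theorem mem_unitCube {x : Fin d → ℝ} : x ∈ unitCube d ↔ ∀ k, 0 ≤ x k ∧ x k ≤ 1 := by
  simp only [unitCube, Set.mem_Icc, Pi.le_def, Pi.zero_apply, Pi.one_apply]
  exact ⟨fun h k => ⟨h.1 k, h.2 k⟩, fun h => ⟨fun k => (h k).1, fun k => (h k).2⟩⟩

theorem convex_unitCube : Convex ℝ (unitCube d) := convex_Icc 0 1

theorem interior_unitCube_nonempty : (interior (unitCube d)).Nonempty := by
  have : unitCube d = Set.univ.pi fun _ => Set.Icc (0 : ℝ) 1 := by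
    ext x; simp only [mem_unitCube, Set.mem_pi, Set.mem_univ, true_implies, Set.mem_Icc]
  rw [this, interior_pi_set Set.finite_univ]
  refine ⟨fun _ => 1 / 2, fun k _ => ?_⟩
  rw [interior_Icc]
  constructor <;> norm_num

theorem uniqueDiffOn_unitCube : UniqueDiffOn ℝ (unitCube d) :=
  uniqueDiffOn_convex convex_unitCube interior_unitCube_nonempty

theorem subset_closure_interior_unitCube : unitCube d ⊆ closure (interior (unitCube d)) := by
  rw [convex_unitCube.closure_interior_eq_closure_of_nonempty_interior interior_unitCube_nonempty]
  exact subset_closure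

theorem cubePartial_congr {f g : (Fin d → ℝ) → ℝ} (i : Fin d) (h : Set.EqOn f g (unitCube d)) :
    Set.EqOn (cubePartial i f) (cubePartial i g) (unitCube d) := fun x hx => by
  simp only [cubePartial]
  rw [fderivWithin_congr h (h hx)]

theorem ContDiffOn.cubePartial {n : ℕ} {f : (Fin d → ℝ) → ℝ}
    (hf : ContDiffOn ℝ ((n + 1 : ℕ) : WithTop ℕ∞) f (unitCube d)) (i : Fin d) :
    ContDiffOn ℝ (n : WithTop ℕ∞) (cubePartial i f) (unitCube d) := by
  have h1 := hf.fderivWithin (m := (n : WithTop ℕ∞)) uniqueDiffOn_unitCube (by push_cast; rfl)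
  exact h1.clm_apply contDiffOn_const

/-- Both sides are values of the second derivative within the cube. Its symmetry also holds at
boundary points, because the cube lies in the closure of its interior. -/
theorem cubePartial_comm {f : (Fin d → ℝ) → ℝ}
    (hf : ContDiffOn ℝ ((2 : ℕ) : WithTop ℕ∞) f (unitCube d)) (i j : Fin d) :
    Set.EqOn (cubePartial i (cubePartial j f)) (cubePartial j (cubePartial i f))
      (unitCube d) := fun x hx => by
  have h1 : ContDiffOn ℝ ((1 : ℕ) : WithTop ℕ∞) (fderivWithin ℝ f (unitCube d)) (unitCube d) :=
    hf.fderivWithin uniqueDiffOn_unitCube (by norm_cast)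
  have h2 : DifferentiableWithinAt ℝ (fderivWithin ℝ f (unitCube d)) (unitCube d) x :=
    h1.differentiableOn (by norm_num) x hx
  have h3 : ∀ k l : Fin d, cubePartial k (cubePartial l f) x =
      fderivWithin ℝ (fderivWithin ℝ f (unitCube d)) (unitCube d) x (Pi.single k 1)
        (Pi.single l 1) := fun k l => by
    have h4 := h2.hasFDerivWithinAt.clm_apply (hasFDerivWithinAt_const (Pi.single l (1 : ℝ)) x
      (unitCube d))
    change fderivWithin ℝ (fun y => fderivWithin ℝ f (unitCube d) y (Pi.single l 1))
      (unitCube d) x (Pi.single k 1) = _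
    rw [h4.fderivWithin (uniqueDiffOn_unitCube x hx)]
    simp
  rw [h3, h3]
  exact (hf x hx).isSymmSndFDerivWithinAt (by simp) uniqueDiffOn_unitCube
    (subset_closure_interior_unitCube hx) hx _ _

theorem cubePartial_iterate_congr {f g : (Fin d → ℝ) → ℝ} (i : Fin d) (n : ℕ)
    (h : Set.EqOn f g (unitCube d)) :
    Set.EqOn ((cubePartial i)^[n] f) ((cubePartial i)^[n] g) (unitCube d) := by
  induction n with
  | zero => exact h
  | succ n ih =>
    rw [Function.iterate_succ_apply', Function.iterate_succ_apply']
    exact cubePartial_congr i ih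

theorem ContDiffOn.cubePartial_iterate {m : ℕ} {f : (Fin d → ℝ) → ℝ} (i : Fin d) (n : ℕ)
    (hf : ContDiffOn ℝ ((m + n : ℕ) : WithTop ℕ∞) f (unitCube d)) :
    ContDiffOn ℝ (m : WithTop ℕ∞) ((_root_.cubePartial i)^[n] f) (unitCube d) := by
  induction n generalizing m with
  | zero => exact hf
  | succ n ih =>
    rw [Function.iterate_succ_apply']
    refine ContDiffOn.cubePartial (ih ?_) i
    rwa [show m + 1 + n = m + (n + 1) by ring]

theorem cubePartial_iterate_comm {f : (Fin d → ℝ) → ℝ} (i j : Fin d) (n : ℕ)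
    (hf : ContDiffOn ℝ ((n + 1 : ℕ) : WithTop ℕ∞) f (unitCube d)) :
    Set.EqOn ((cubePartial i)^[n] (cubePartial j f)) (cubePartial j ((cubePartial i)^[n] f))
      (unitCube d) := by
  induction n with
  | zero => exact fun _ _ => rfl
  | succ n ih =>
    rw [Function.iterate_succ_apply', Function.iterate_succ_apply']
    refine (cubePartial_congr i (ih (hf.of_le (by norm_cast; omega)))).trans
      (cubePartial_comm (ContDiffOn.cubePartial_iterate i n ?_) i j)
    rwa [show 2 + n = n + 1 + 1 by ring]

/-- Iterated partial derivatives along a list of directions. -/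
noncomputable def listPartial (l : List (Fin d)) (k : Fin d → ℕ) (f : (Fin d → ℝ) → ℝ) :
    (Fin d → ℝ) → ℝ :=
  l.foldr (fun i g => (cubePartial i)^[k i] g) f

theorem listPartial_cons (a : Fin d) (l : List (Fin d)) (k : Fin d → ℕ)
    (f : (Fin d → ℝ) → ℝ) :
    listPartial (a :: l) k f = (cubePartial a)^[k a] (listPartial l k f) := rfl

theorem ContDiffOn.listPartial (l : List (Fin d)) (k : Fin d → ℕ) {m : ℕ}
    {f : (Fin d → ℝ) → ℝ}
    (hf : ContDiffOn ℝ ((m + (l.map k).sum : ℕ) : WithTop ℕ∞) f (unitCube d)) :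
    ContDiffOn ℝ (m : WithTop ℕ∞) (listPartial l k f) (unitCube d) := by
  induction l generalizing m with
  | nil => simpa [_root_.listPartial] using hf
  | cons a l ih =>
    rw [listPartial_cons]
    refine ContDiffOn.cubePartial_iterate a (k a) (ih ?_)
    rwa [List.map_cons, List.sum_cons, ← add_assoc] at hf

theorem listPartial_cubePartial (l : List (Fin d)) (k : Fin d → ℕ) (j : Fin d)
    {f : (Fin d → ℝ) → ℝ}
    (hf : ContDiffOn ℝ (((l.map k).sum + 1 : ℕ) : WithTop ℕ∞) f (unitCube d)) :
    Set.EqOn (listPartial l k (cubePartial j f)) (cubePartial j (listPartial l k f))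
      (unitCube d) := by
  induction l with
  | nil => exact fun _ _ => rfl
  | cons a l ih =>
    rw [List.map_cons, List.sum_cons] at hf
    rw [listPartial_cons, listPartial_cons]
    refine (cubePartial_iterate_congr a (k a) (ih (hf.of_le (by norm_cast; omega)))).trans
      (cubePartial_iterate_comm a j (k a) (ContDiffOn.listPartial l k ?_))
    rwa [show k a + 1 + (l.map k).sum = k a + (l.map k).sum + 1 by ring]

theorem listPartial_congr_index (l : List (Fin d)) {k k' : Fin d → ℕ} (f : (Fin d → ℝ) → ℝ)
    (h : ∀ i ∈ l, k i = k' i) : listPartial l k f = listPartial l k' f := by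
  induction l with
  | nil => rfl
  | cons a l ih =>
    rw [listPartial_cons, listPartial_cons, h a (by simp), ih fun i hi => h i (by simp [hi])]

/-- In a list without repetitions, raising `k j` inserts exactly one extra `cubePartial j`, which is
then commuted outwards past the directions listed before `j`. -/
theorem listPartial_add_single (l : List (Fin d)) (hl : l.Nodup) (k : Fin d → ℕ) (j : Fin d)
    (hj : j ∈ l) {f : (Fin d → ℝ) → ℝ}
    (hf : ContDiffOn ℝ (((l.map k).sum + 1 : ℕ) : WithTop ℕ∞) f (unitCube d)) :
    Set.EqOn (listPartial l (k + Pi.single j 1) f) (cubePartial j (listPartial l k f))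
      (unitCube d) := by
  induction l with
  | nil => simp at hj
  | cons a l ih =>
    rw [List.map_cons, List.sum_cons] at hf
    rw [List.nodup_cons] at hl
    rw [listPartial_cons, listPartial_cons]
    by_cases haj : a = j
    · subst haj
      rw [listPartial_congr_index l (k := k + Pi.single a 1) (k' := k) f fun i hi => by
        have : i ≠ a := fun h => hl.1 (h ▸ hi)
        simp [this]]
      simp only [Pi.add_apply, Pi.single_eq_same, Function.iterate_succ_apply']
      exact fun _ _ => rfl
    · have hj' : j ∈ l := by
        rcases List.mem_cons.1 hj with h | h
        · exact absurd h.symm haj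
        · exact h
      have : (k + Pi.single j 1 : Fin d → ℕ) a = k a := by simp [haj]
      rw [this]
      refine (cubePartial_iterate_congr a (k a)
        (ih hl.2 hj' (hf.of_le (by norm_cast; omega)))).trans
        (cubePartial_iterate_comm a j (k a) (ContDiffOn.listPartial l k ?_))
      rwa [show k a + 1 + (l.map k).sum = k a + (l.map k).sum + 1 by ring]

theorem sum_map_finRange (k : Fin d → ℕ) : ((List.finRange d).map k).sum = ∑ i, k i := by
  rw [Fin.sum_univ_def]

theorem ContDiffOn.multiPartial (k : Fin d → ℕ) {m : ℕ} {f : (Fin d → ℝ) → ℝ}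
    (hf : ContDiffOn ℝ ((m + ∑ i, k i : ℕ) : WithTop ℕ∞) f (unitCube d)) :
    ContDiffOn ℝ (m : WithTop ℕ∞) (multiPartial k f) (unitCube d) :=
  ContDiffOn.listPartial (List.finRange d) k (by rwa [sum_map_finRange])

/-- A single derivative can be split off on the inside, as the induction on the Taylor degree needs,
or on the outside (`cubePartial_multiPartial`), as the Lipschitz bound below the top order needs. -/
theorem multiPartial_cubePartial (k : Fin d → ℕ) (j : Fin d) {f : (Fin d → ℝ) → ℝ}
    (hf : ContDiffOn ℝ ((∑ i, k i + 1 : ℕ) : WithTop ℕ∞) f (unitCube d)) :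
    Set.EqOn (multiPartial k (cubePartial j f)) (multiPartial (k + Pi.single j 1) f)
      (unitCube d) :=
  (listPartial_cubePartial (List.finRange d) k j (by rwa [sum_map_finRange])).trans
    (listPartial_add_single (List.finRange d) (List.nodup_finRange d) k j (by simp)
      (by rwa [sum_map_finRange])).symm

theorem cubePartial_multiPartial (k : Fin d → ℕ) (j : Fin d) {f : (Fin d → ℝ) → ℝ}
    (hf : ContDiffOn ℝ ((∑ i, k i + 1 : ℕ) : WithTop ℕ∞) f (unitCube d)) :
    Set.EqOn (cubePartial j (multiPartial k f)) (multiPartial (k + Pi.single j 1) f)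
      (unitCube d) :=
  (listPartial_add_single (List.finRange d) (List.nodup_finRange d) k j (by simp)
      (by rwa [sum_map_finRange])).symm

theorem multiPartial_zero (f : (Fin d → ℝ) → ℝ) : multiPartial (0 : Fin d → ℕ) f = f := by
  unfold multiPartial
  induction List.finRange d with
  | nil => rfl
  | cons a l ih => rw [List.foldr_cons, ih]; rfl

/-- The operator norm of a functional for the sup-norm is at most the `ℓ¹`-norm of its
coefficients. -/
theorem opNorm_le_sum_single (φ : (Fin d → ℝ) →L[ℝ] ℝ) : ‖φ‖ ≤ ∑ i, |φ (Pi.single i 1)| := by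
  refine φ.opNorm_le_bound (Finset.sum_nonneg fun _ _ => abs_nonneg _) fun v => ?_
  have hv : φ v = ∑ i, v i * φ (Pi.single i 1) := by
    conv_lhs => rw [pi_eq_sum_univ' v, map_sum]
    refine Finset.sum_congr rfl fun i _ => ?_
    rw [map_smul, smul_eq_mul]
  rw [hv, Finset.sum_mul]
  refine (Finset.abs_sum_le_sum_abs _ _).trans (Finset.sum_le_sum fun i _ => ?_)
  rw [abs_mul, mul_comm]
  gcongr
  exact norm_le_pi_norm v i

/-- Mean value inequality on the cube between `x` and `y`, in terms of the partial derivatives. -/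
theorem abs_sub_le_of_partial_le {f : (Fin d → ℝ) → ℝ}
    {f' : (Fin d → ℝ) → (Fin d → ℝ) →L[ℝ] ℝ}
    (hf : ∀ z ∈ unitCube d, HasFDerivWithinAt f (f' z) (unitCube d) z) {x y : Fin d → ℝ}
    (hx : x ∈ unitCube d) (hy : y ∈ unitCube d) {B : ℝ}
    (hB : ∀ z ∈ unitCube d, ‖z - x‖ ≤ ‖y - x‖ → ∀ i, |f' z (Pi.single i 1)| ≤ B) :
    |f y - f x| ≤ d * B * ‖y - x‖ := by
  -- Intersecting with the ball keeps the segment inside a convex set on which the partial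
  -- derivatives only have to be controlled at distance at most `‖y - x‖` from `x`.
  have hc : Convex ℝ (unitCube d ∩ Metric.closedBall x ‖y - x‖) :=
    convex_unitCube.inter (convex_closedBall _ _)
  refine hc.norm_image_sub_le_of_norm_hasFDerivWithin_le (f' := f')
    (fun z hz => (hf z hz.1).mono Set.inter_subset_left) (fun z hz => ?_)
    ⟨hx, by simp⟩ ⟨hy, by simp [dist_eq_norm]⟩
  refine (opNorm_le_sum_single _).trans ?_
  have hz2 : ‖z - x‖ ≤ ‖y - x‖ := by simpa [dist_eq_norm] using hz.2
  calc _ ≤ ∑ _i : Fin d, B := Finset.sum_le_sum fun i _ => hB z hz.1 hz2 i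
    _ = d * B := by simp

/-! ### Taylor expansion with Hölder remainder. -/

/-- The multi-indices of order at most `q`. -/
def multiIndices (d q : ℕ) : Finset (Fin d → ℕ) :=
  (Fintype.piFinset fun _ => Finset.range (q + 1)).filter fun r => ∑ i, r i ≤ q

theorem mem_multiIndices {q : ℕ} {r : Fin d → ℕ} : r ∈ multiIndices d q ↔ ∑ i, r i ≤ q := by
  simp only [multiIndices, Finset.mem_filter, Fintype.mem_piFinset, Finset.mem_range,
    and_iff_right_iff_imp]
  intro h i
  have := Finset.single_le_sum (f := r) (fun _ _ => Nat.zero_le _) (Finset.mem_univ i)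
  omega

/-- The coefficient of the Taylor polynomial at `x`. -/
noncomputable def taylorCoeff (f : (Fin d → ℝ) → ℝ) (x : Fin d → ℝ) (r : Fin d → ℕ) : ℝ :=
  multiPartial r f x / ∏ k, ((r k).factorial : ℝ)

/-- The Taylor polynomial of degree `q` at `x`. -/
noncomputable def cubeTaylor (q : ℕ) (f : (Fin d → ℝ) → ℝ) (x y : Fin d → ℝ) : ℝ :=
  ∑ r ∈ multiIndices d q, taylorCoeff f x r * ∏ k, (y k - x k) ^ (r k)

theorem sum_add_single (r : Fin d → ℕ) (i : Fin d) :
    ∑ k, (r + Pi.single i 1 : Fin d → ℕ) k = ∑ k, r k + 1 := by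
  simp [Finset.sum_add_distrib]

theorem prod_update_pow (r : Fin d → ℕ) (i : Fin d) (u : Fin d → ℝ) :
    ∏ k, u k ^ (r k) = u i ^ (r i) * ∏ k ∈ Finset.univ.erase i, u k ^ (r k) :=
  (Finset.mul_prod_erase _ _ (Finset.mem_univ i)).symm

theorem taylorCoeff_cubePartial {f : (Fin d → ℝ) → ℝ} {q : ℕ}
    (hf : ContDiffOn ℝ ((q + 1 : ℕ) : WithTop ℕ∞) f (unitCube d)) {x : Fin d → ℝ}
    (hx : x ∈ unitCube d) {r : Fin d → ℕ} (hr : ∑ i, r i ≤ q) (i : Fin d) :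
    taylorCoeff f x (r + Pi.single i 1) * (r i + 1 : ℝ) = taylorCoeff (cubePartial i f) x r := by
  unfold taylorCoeff
  rw [multiPartial_cubePartial r i (hf.of_le (by norm_cast; omega)) hx]
  have h1 : ∏ k, (((r + Pi.single i 1 : Fin d → ℕ) k).factorial : ℝ) =
      (r i + 1) * ∏ k, ((r k).factorial : ℝ) := by
    rw [← Finset.mul_prod_erase _ _ (Finset.mem_univ i),
      ← Finset.mul_prod_erase (Finset.univ) (fun k => ((r k).factorial : ℝ)) (Finset.mem_univ i)]
    have h2 : ∏ k ∈ Finset.univ.erase i, (((r + Pi.single i 1 : Fin d → ℕ) k).factorial : ℝ) =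
        ∏ k ∈ Finset.univ.erase i, ((r k).factorial : ℝ) :=
      Finset.prod_congr rfl fun k hk => by simp [Finset.ne_of_mem_erase hk]
    rw [h2]
    simp only [Pi.add_apply, Pi.single_eq_same, Nat.factorial_succ]
    push_cast; ring
  rw [h1]
  have : (r i + 1 : ℝ) ≠ 0 := by positivity
  have h3 : ∏ k, ((r k).factorial : ℝ) ≠ 0 :=
    Finset.prod_ne_zero_iff.2 fun k _ => by positivity
  field_simp

theorem differentiable_cubeTaylor (q : ℕ) (f : (Fin d → ℝ) → ℝ) (x : Fin d → ℝ) :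
    Differentiable ℝ (cubeTaylor q f x) := by
  unfold cubeTaylor
  fun_prop

/-- Differentiating a Taylor polynomial gives the Taylor polynomial, one degree lower, of the
derivative; this drives the induction for the remainder. The derivative along a coordinate line is
computed in two ways. -/
theorem fderiv_cubeTaylor {f : (Fin d → ℝ) → ℝ} {q : ℕ}
    (hf : ContDiffOn ℝ ((q + 1 : ℕ) : WithTop ℕ∞) f (unitCube d)) {x : Fin d → ℝ}
    (hx : x ∈ unitCube d) (y : Fin d → ℝ) (i : Fin d) :
    fderiv ℝ (cubeTaylor (q + 1) f x) y (Pi.single i 1) =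
      cubeTaylor q (cubePartial i f) x y := by
  have h1 : HasDerivAt (fun t : ℝ => cubeTaylor (q + 1) f x (y + t • Pi.single i 1))
      (fderiv ℝ (cubeTaylor (q + 1) f x) y (Pi.single i 1)) 0 := by
    have := (differentiable_cubeTaylor (q + 1) f x y).hasFDerivAt.hasLineDerivAt (Pi.single i 1)
    exact this
  have h2 : HasDerivAt (fun t : ℝ => cubeTaylor (q + 1) f x (y + t • Pi.single i 1))
      (∑ r ∈ multiIndices d (q + 1), taylorCoeff f x r *
        ((r i * (y i - x i) ^ (r i - 1)) *
          ∏ k ∈ Finset.univ.erase i, (y k - x k) ^ (r k))) 0 := by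
    unfold cubeTaylor
    refine HasDerivAt.fun_sum fun r _ => HasDerivAt.const_mul _ ?_
    have h3 : (fun t : ℝ => ∏ k, ((y + t • Pi.single i (1 : ℝ) : Fin d → ℝ) k - x k) ^ (r k)) =
        fun t : ℝ => (y i + t - x i) ^ (r i) *
          ∏ k ∈ Finset.univ.erase i, (y k - x k) ^ (r k) := by
      ext t
      rw [← Finset.mul_prod_erase _ _ (Finset.mem_univ i)]
      congr 1
      · simp
      · exact Finset.prod_congr rfl fun k hk => by simp [Finset.ne_of_mem_erase hk]
    rw [h3]
    have h4 : HasDerivAt (fun t : ℝ => (y i + t - x i)) 1 0 := by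
      simpa using ((hasDerivAt_id (0 : ℝ)).const_add (y i)).sub_const (x i)
    simpa using (h4.pow (r i)).mul_const _
  rw [h1.unique h2]
  have hinj : Function.Injective fun r : Fin d → ℕ => r + Pi.single i 1 :=
    fun r r' h => by simpa using h
  have hsub : (multiIndices d q).image (fun r => r + Pi.single i 1) ⊆ multiIndices d (q + 1) := by
    intro r hr
    obtain ⟨r', hr', rfl⟩ := Finset.mem_image.1 hr
    rw [mem_multiIndices] at hr' ⊢
    rw [sum_add_single]; omega
  -- The surviving terms are reindexed by adding one to the coordinate `i`. The indices missed have
  -- `r i = 0`, so the factor `r i` kills them and the truncated exponent `r i - 1` does not matter.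
  rw [← Finset.sum_subset hsub, Finset.sum_image fun _ _ _ _ h => hinj h]
  · refine Finset.sum_congr rfl fun r hr => ?_
    rw [mem_multiIndices] at hr
    rw [← taylorCoeff_cubePartial hf hx hr i, prod_update_pow r i fun k => y k - x k]
    have h2 : ∏ k ∈ Finset.univ.erase i, (y k - x k) ^ ((r + Pi.single i 1 : Fin d → ℕ) k) =
        ∏ k ∈ Finset.univ.erase i, (y k - x k) ^ (r k) :=
      Finset.prod_congr rfl fun k hk => by simp [Finset.ne_of_mem_erase hk]
    rw [h2]
    simp only [Pi.add_apply, Pi.single_eq_same, Nat.add_sub_cancel]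
    push_cast; ring
  · intro r hr hr'
    have hri : r i = 0 := by
      by_contra h0
      refine hr' (Finset.mem_image.2 ⟨r - Pi.single i 1, ?_, ?_⟩)
      · have h5 : r - Pi.single i 1 + Pi.single i 1 = r := by
          ext k; by_cases hk : k = i
          · subst hk; simp; omega
          · simp [hk]
        have h6 := sum_add_single (r - Pi.single i 1) i
        rw [h5] at h6
        rw [mem_multiIndices] at hr ⊢
        omega
      · ext k; by_cases hk : k = i
        · subst hk; simp; omega
        · simp [hk]
    simp [hri]

theorem cubeTaylor_self (q : ℕ) (f : (Fin d → ℝ) → ℝ) (x : Fin d → ℝ) :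
    cubeTaylor q f x x = f x := by
  unfold cubeTaylor
  rw [Finset.sum_eq_single (0 : Fin d → ℕ)]
  · simp [taylorCoeff, multiPartial_zero]
  · intro r _ hr
    obtain ⟨k, hk⟩ : ∃ k, r k ≠ 0 := by
      by_contra! h
      exact hr (funext h)
    rw [Finset.prod_eq_zero (Finset.mem_univ k) (by simp [hk]), mul_zero]
  · intro h
    exact absurd (mem_multiIndices.2 (by simp)) h

/-- Functions on the cube that are `q` times continuously differentiable and whose partial
derivatives of order `q` are Hölder continuous of exponent `γ` with constant `A`. -/
structure HolderTop (q : ℕ) (γ A : ℝ) (f : (Fin d → ℝ) → ℝ) : Prop where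
  contDiffOn : ContDiffOn ℝ (q : WithTop ℕ∞) f (unitCube d)
  holder : ∀ k : Fin d → ℕ, ∑ i, k i = q → ∀ x ∈ unitCube d, ∀ y ∈ unitCube d,
    |multiPartial k f x - multiPartial k f y| ≤ A * ‖x - y‖ ^ γ

theorem HolderTop.cubePartial {q : ℕ} {γ A : ℝ} {f : (Fin d → ℝ) → ℝ}
    (hf : HolderTop (q + 1) γ A f) (i : Fin d) : HolderTop q γ A (cubePartial i f) where
  contDiffOn := hf.contDiffOn.cubePartial i
  holder k hk x hx y hy := by
    have h1 := multiPartial_cubePartial k i (by rw [hk]; exact hf.contDiffOn)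
    rw [h1 hx, h1 hy]
    exact hf.holder _ (by rw [sum_add_single, hk]) x hx y hy

/-- Taylor's theorem on the cube with a Hölder remainder. -/
theorem HolderTop.abs_sub_cubeTaylor_le {q : ℕ} {γ A : ℝ} (hγ : 0 < γ) (hA : 0 ≤ A)
    {f : (Fin d → ℝ) → ℝ} (hf : HolderTop q γ A f) {x y : Fin d → ℝ} (hx : x ∈ unitCube d)
    (hy : y ∈ unitCube d) :
    |f y - cubeTaylor q f x y| ≤ (d : ℝ) ^ q * A * ‖y - x‖ ^ ((q : ℝ) + γ) := by
  induction q generalizing f y with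
  | zero =>
    have h1 : cubeTaylor 0 f x y = f x := by
      unfold cubeTaylor
      rw [show multiIndices d 0 = {0} by
        ext r; simp [mem_multiIndices, funext_iff]]
      simp [taylorCoeff, multiPartial_zero]
    have h2 := hf.holder 0 (by simp) y hy x hx
    rw [multiPartial_zero] at h2
    simpa [h1] using h2
  | succ q ih =>
    -- `B` is the remainder bound of degree `q` for the partial derivatives of `f`. The mean value
    -- inequality multiplies it by `d * ‖y - x‖`, which accounts for one more factor of each.
    set B : ℝ := (d : ℝ) ^ q * A * ‖y - x‖ ^ ((q : ℝ) + γ) with hB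
    have h1 := abs_sub_le_of_partial_le
      (f := fun z => f z - cubeTaylor (q + 1) f x z)
      (f' := fun z => fderivWithin ℝ f (unitCube d) z - fderiv ℝ (cubeTaylor (q + 1) f x) z)
      (fun z hz => ((hf.contDiffOn.differentiableOn (by norm_cast) z
        hz).hasFDerivWithinAt).sub
          (differentiable_cubeTaylor _ f x z).hasFDerivAt.hasFDerivWithinAt) hx hy (B := B)
      (fun z hz hzx i => by
        rw [_root_.sub_apply, fderiv_cubeTaylor hf.contDiffOn hx z i]
        refine (ih (hf.cubePartial i) hz).trans ?_
        rw [hB]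
        gcongr)
    simp only [cubeTaylor_self, sub_self, sub_zero] at h1
    refine h1.trans (le_of_eq ?_)
    rcases eq_or_ne ‖y - x‖ 0 with h0 | h0
    · rw [h0, Real.zero_rpow (by push_cast; positivity)]; simp
    · rw [hB, show ((q + 1 : ℕ) : ℝ) + γ = ((q : ℝ) + γ) + 1 by push_cast; ring,
        Real.rpow_add_one h0, pow_succ]
      ring

/-! ### Consequences of a finite Hölder norm. -/

/-- The random bound `M` of a path may be negative, where `ENNReal.ofReal` truncates; `max M 0` is
the constant to be used in real inequalities. -/
theorem ofReal_eq_ofReal_max_zero (M : ℝ) : ENNReal.ofReal M = ENNReal.ofReal (max M 0) := by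
  rcases le_total M 0 with h | h
  · rw [max_eq_right h, ENNReal.ofReal_of_nonpos h, ENNReal.ofReal_zero]
  · rw [max_eq_left h]

theorem HolderClass.abs_multiPartial_le {α M : ℝ} {f : (Fin d → ℝ) → ℝ}
    (hf : HolderClass α M f) {k : Fin d → ℕ} (hk : ∑ i, k i ≤ strictFloor α)
    {x : Fin d → ℝ} (hx : x ∈ unitCube d) : |multiPartial k f x| ≤ max M 0 := by
  have h1 : ENNReal.ofReal |multiPartial k f x| ≤ ENNReal.ofReal M := by
    refine le_trans ?_ hf.2
    unfold holderNorm
    refine le_trans ?_ le_self_add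
    exact le_iSup₂_of_le k hk (le_iSup₂_of_le x hx le_rfl)
  rw [ofReal_eq_ofReal_max_zero M] at h1
  exact (ENNReal.ofReal_le_ofReal_iff (le_max_right _ _)).1 h1

theorem HolderClass.abs_sub_le {α M : ℝ} {f : (Fin d → ℝ) → ℝ} (hα : 0 < α)
    (hf : HolderClass α M f) {k : Fin d → ℕ} (hk : ∑ i, k i = strictFloor α)
    {x y : Fin d → ℝ} (hx : x ∈ unitCube d) (hy : y ∈ unitCube d) :
    |multiPartial k f x - multiPartial k f y| ≤
      max M 0 * ‖x - y‖ ^ (α - (strictFloor α : ℝ)) := by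
  rcases eq_or_ne x y with rfl | hxy
  · have h0 : (0 : ℝ) < α - (strictFloor α : ℝ) := sub_pos.2 (strictFloor_isGreatest hα).1
    simp [Real.zero_rpow h0.ne']
  have h1 : ENNReal.ofReal (|multiPartial k f x - multiPartial k f y| /
      ‖x - y‖ ^ (α - (strictFloor α : ℝ))) ≤ ENNReal.ofReal M := by
    refine le_trans ?_ hf.2
    unfold holderNorm
    refine le_trans ?_ le_add_self
    exact le_iSup₂_of_le k hk (le_iSup₂_of_le x hx (le_iSup₂_of_le y hy
      (le_iSup_of_le hxy le_rfl)))
  rw [ofReal_eq_ofReal_max_zero M] at h1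
  have h2 := (ENNReal.ofReal_le_ofReal_iff (le_max_right _ _)).1 h1
  have h3 : 0 < ‖x - y‖ ^ (α - (strictFloor α : ℝ)) :=
    Real.rpow_pos_of_pos (norm_pos_iff.2 (sub_ne_zero.2 hxy)) _
  rwa [div_le_iff₀ h3] at h2

theorem HolderClass.holderTop {α M : ℝ} {f : (Fin d → ℝ) → ℝ} (hα : 0 < α)
    (hf : HolderClass α M f) :
    HolderTop (strictFloor α) (α - (strictFloor α : ℝ)) (max M 0) f where
  contDiffOn := hf.1
  holder _ hk _ hx _ hy := hf.abs_sub_le hα hk hx hy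

/-- Below the top order, the partial derivatives are Lipschitz continuous. -/
theorem HolderClass.holderTop_of_lt {α M : ℝ} {f : (Fin d → ℝ) → ℝ}
    (hf : HolderClass α M f) {q : ℕ} (hq : q < strictFloor α) :
    HolderTop q 1 (d * max M 0) f where
  contDiffOn := hf.1.of_le (by norm_cast; omega)
  holder k hk x hx y hy := by
    rw [Real.rpow_one]
    have h0 : ContDiffOn ℝ ((1 : ℕ) : WithTop ℕ∞) (multiPartial k f) (unitCube d) :=
      ContDiffOn.multiPartial k (hf.1.of_le (by norm_cast; omega))
    refine abs_sub_le_of_partial_le (f' := fun z => fderivWithin ℝ (multiPartial k f)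
      (unitCube d) z) (fun z hz => (h0.differentiableOn (by norm_num) z hz).hasFDerivWithinAt)
      hy hx fun z hz _ i => ?_
    have h1 : cubePartial i (multiPartial k f) z = multiPartial (k + Pi.single i 1) f z :=
      cubePartial_multiPartial k i (hf.1.of_le (by norm_cast; omega)) hz
    change |cubePartial i (multiPartial k f) z| ≤ _
    rw [h1]
    exact hf.abs_multiPartial_le (by rw [sum_add_single]; omega) hz

end CubeCalculus

/-! ### The functional defined by the weights, acting on Hölder functions. -/

section Weights

variable {d : ℕ}

theorem pMin_le {p : Fin d → ℕ} (k : Fin d) : pMin p ≤ p k := ciInf_le (OrderBot.bddBelow _) k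

theorem pProd_pos {p : Fin d → ℕ} (hp : 1 ≤ pMin p) : 0 < pProd p :=
  Finset.prod_pos fun k _ => lt_of_lt_of_le hp (pMin_le k)

theorem pMin_le_pProd (hd : 1 ≤ d) {p : Fin d → ℕ} (hp : 1 ≤ pMin p) : pMin p ≤ pProd p :=
  (pMin_le ⟨0, hd⟩).trans (Finset.single_le_prod' (f := p)
    (fun k _ => hp.trans (pMin_le k)) (Finset.mem_univ _))

theorem RegularDesign.designPoint_mem {Cd : ℝ} {p : Fin d → ℕ} {t : ∀ k : Fin d, Fin (p k) → ℝ}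
    (ht : RegularDesign Cd p t) (j : Grid p) : designPoint t j ∈ unitCube d :=
  mem_unitCube.2 fun k => ht.mem_unit k (j k)

/-- The constant in the bound for the number of design points in a window. -/
noncomputable def windowConst (d : ℕ) (Cd c : ℝ) : ℝ := Cd * (max 1 (1 / c)) ^ d

theorem windowConst_pos {Cd c : ℝ} (hCd : 0 < Cd) : 0 < windowConst d Cd c := by
  unfold windowConst; positivity

/-- The design condition requires a half-width of at least `1 / p_min`, but `h` only exceeds `c /
p_min`. Widening the window by the factor `max 1 (1 / c)` repairs this and produces `windowConst`.
-/
theorem RegularDesign.card_filter_le {Cd c : ℝ} (hc : 0 < c) {p : Fin d → ℕ}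
    {t : ∀ k : Fin d, Fin (p k) → ℝ} (ht : RegularDesign Cd p t) {h : ℝ}
    (hp : 1 ≤ pMin p) (hh : c / pMin p < h) {x : Fin d → ℝ} (hx : x ∈ unitCube d) :
    ((Finset.univ.filter fun j : Grid p => ‖x - designPoint t j‖ ≤ h).card : ℝ) ≤
      windowConst d Cd c * h ^ d * pProd p := by
  have hp' : (0 : ℝ) < pMin p := by exact_mod_cast hp
  have hh0 : 0 < h := lt_trans (by positivity) hh
  have h1 : 1 / (pMin p : ℝ) ≤ max 1 (1 / c) * h := by
    calc 1 / (pMin p : ℝ) = 1 / c * (c / pMin p) := by field_simp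
      _ ≤ max 1 (1 / c) * h := by gcongr; exact le_max_right _ _
  refine le_trans ?_ (le_trans (ht.card_le x hx _ h1) (le_of_eq ?_))
  · rw [Nat.card_eq_fintype_card, Fintype.card_subtype]
    norm_cast
    refine Finset.card_le_card fun j hj => ?_
    rw [Finset.mem_filter] at hj ⊢
    refine ⟨Finset.mem_univ _, fun k => ?_⟩
    have h2 := (norm_le_pi_norm (x - designPoint t j) k).trans hj.2
    have h3 : h ≤ max 1 (1 / c) * h := le_mul_of_one_le_left hh0.le (le_max_left _ _)
    rw [Pi.sub_apply, Real.norm_eq_abs, abs_le] at h2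
    constructor <;> linarith
  · unfold windowConst; rw [mul_pow]; ring

theorem RegularDesign.abs_sum_le {Cd c : ℝ} (hc : 0 < c) {p : Fin d → ℕ}
    {t : ∀ k : Fin d, Fin (p k) → ℝ} (ht : RegularDesign Cd p t) {h : ℝ}
    (hp : 1 ≤ pMin p) (hh : c / pMin p < h) {x : Fin d → ℝ} (hx : x ∈ unitCube d)
    {g : Grid p → ℝ} {B : ℝ} (hB : 0 ≤ B)
    (hg : ∀ j, ‖x - designPoint t j‖ ≤ h → |g j| ≤ B)
    (hg0 : ∀ j, h < ‖x - designPoint t j‖ → g j = 0) :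
    |∑ j, g j| ≤ windowConst d Cd c * h ^ d * pProd p * B := by
  calc |∑ j, g j| ≤ ∑ j, |g j| := Finset.abs_sum_le_sum_abs _ _
    _ = ∑ j ∈ Finset.univ.filter (fun j : Grid p => ‖x - designPoint t j‖ ≤ h), |g j| := by
      refine (Finset.sum_filter_of_ne fun j _ hj => ?_).symm
      by_contra h1
      exact hj (by rw [hg0 j (not_le.1 h1), abs_zero])
    _ ≤ (Finset.univ.filter fun j : Grid p => ‖x - designPoint t j‖ ≤ h).card • B :=
      Finset.sum_le_card_nsmul _ _ _ fun j hj => hg j (Finset.mem_filter.1 hj).2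
    _ ≤ _ := by
      rw [nsmul_eq_mul]
      gcongr
      exact ht.card_filter_le hc hp hh hx

variable {s : Fin d → ℕ} {m : ℕ} {c h₀ C₁ C₂ Cd : ℝ} {p : Fin d → ℕ}
  {t : ∀ k : Fin d, Fin (p k) → ℝ} {w : ℝ → (Fin d → ℝ) → Grid p → ℝ}

theorem eq_of_le_of_sum_le {q r s : Fin d → ℕ} (hqr : ∀ k, q k ≤ r k)
    (hr : ∑ k, r k ≤ ∑ k, s k) (hq : q = s) : r = s := by
  subst hq
  have h1 := (Finset.sum_eq_sum_iff_of_le fun k _ => hqr k).1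
    (le_antisymm (Finset.sum_le_sum fun k _ => hqr k) hr)
  exact funext fun k => (h1 k (Finset.mem_univ k)).symm

/-- Up to the order of the estimated derivative, the centre of the monomials is irrelevant. -/
theorem WeightCondition.reproduce_shift (hw : WeightCondition s m c h₀ C₁ C₂ p t w)
    (hs : ∑ k, s k ≤ m) {h : ℝ} (hh : h ∈ Set.Ioc (c / (pMin p : ℝ)) h₀) {y : Fin d → ℝ}
    (hy : y ∈ unitCube d) (z : Fin d → ℝ) {r : Fin d → ℕ} (hr : ∑ k, r k ≤ ∑ k, s k) :
    ∑ j : Grid p, (∏ k, (designPoint t j k - z k) ^ (r k)) * w h y j =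
      if r = s then ∏ k, ((s k).factorial : ℝ) else 0 := by
  -- The monomial centred at `z` is expanded binomially around `y`. Only the exponent `q = s` can
  -- contribute, and `q ≤ r` with `|r| ≤ |s|` then forces `r = s`, whose leading coefficient is one.
  have h1 : ∀ j : Grid p, ∏ k, (designPoint t j k - z k) ^ (r k) =
      ∑ q ∈ Fintype.piFinset fun k => Finset.range (r k + 1),
        (∏ k, ((y k - z k) ^ (r k - q k) * ((r k).choose (q k) : ℝ))) *
          ∏ k, (designPoint t j k - y k) ^ (q k) := fun j => by
    have h2 : ∀ k, (designPoint t j k - z k) ^ (r k) = ∑ i ∈ Finset.range (r k + 1),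
        (designPoint t j k - y k) ^ i * (y k - z k) ^ (r k - i) * ((r k).choose i : ℝ) :=
      fun k => by rw [← add_pow]; ring
    rw [Finset.prod_congr rfl fun k _ => h2 k, Finset.prod_univ_sum]
    refine Finset.sum_congr rfl fun q _ => ?_
    rw [← Finset.prod_mul_distrib]
    exact Finset.prod_congr rfl fun k _ => by ring
  simp_rw [h1, Finset.sum_mul]
  rw [Finset.sum_comm]
  have h3 : ∀ q ∈ Fintype.piFinset fun k => Finset.range (r k + 1),
      ∑ j : Grid p, (∏ k, ((y k - z k) ^ (r k - q k) * ((r k).choose (q k) : ℝ))) *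
          (∏ k, (designPoint t j k - y k) ^ (q k)) * w h y j =
        if q = s then (∏ k, ((y k - z k) ^ (r k - q k) * ((r k).choose (q k) : ℝ))) *
          ∏ k, ((s k).factorial : ℝ) else 0 := fun q hq => by
    have hqr : ∀ k, q k ≤ r k := fun k => by
      have := Finset.mem_range.1 (Fintype.mem_piFinset.1 hq k); omega
    simp_rw [mul_assoc]
    rw [← Finset.mul_sum, hw.reproduce h hh y hy q
      ((Finset.sum_le_sum fun k _ => hqr k).trans (hr.trans hs)), mul_ite, mul_zero]
  rw [Finset.sum_congr rfl h3, Finset.sum_ite_eq']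
  by_cases hrs : r = s
  · subst hrs
    simp
  · rw [if_neg hrs, if_neg]
    intro hmem
    refine hrs (eq_of_le_of_sum_le (q := s) (fun k => ?_) hr rfl)
    have := Finset.mem_range.1 (Fintype.mem_piFinset.1 hmem k); omega

/-- The linear functional applied by the estimator. -/
noncomputable def weightSum (t : ∀ k : Fin d, Fin (p k) → ℝ) (w : ℝ → (Fin d → ℝ) → Grid p → ℝ)
    (h : ℝ) (x : Fin d → ℝ) (f : (Fin d → ℝ) → ℝ) : ℝ :=
  ∑ j : Grid p, w h x j * f (designPoint t j)

theorem weightSum_cubeTaylor (h : ℝ) (x y : Fin d → ℝ) (q : ℕ) (f : (Fin d → ℝ) → ℝ) :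
    weightSum t w h y (cubeTaylor q f x) = ∑ r ∈ multiIndices d q, taylorCoeff f x r *
      ∑ j : Grid p, (∏ k, (designPoint t j k - x k) ^ (r k)) * w h y j := by
  unfold weightSum cubeTaylor
  simp_rw [Finset.mul_sum]
  rw [Finset.sum_comm]
  exact Finset.sum_congr rfl fun r _ => Finset.sum_congr rfl fun j _ => by ring

theorem sum_taylorCoeff_ite (q : ℕ) (f : (Fin d → ℝ) → ℝ) (x : Fin d → ℝ) :
    ∑ r ∈ multiIndices d q, taylorCoeff f x r *
      (if r = s then ∏ k, ((s k).factorial : ℝ) else 0) =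
      if ∑ k, s k ≤ q then multiPartial s f x else 0 := by
  simp_rw [mul_ite, mul_zero]
  rw [Finset.sum_ite_eq']
  simp only [mem_multiIndices]
  congr 1
  unfold taylorCoeff
  exact div_mul_cancel₀ _ (Finset.prod_ne_zero_iff.2 fun k _ => by positivity)

theorem WeightCondition.weightSum_cubeTaylor_self (hw : WeightCondition s m c h₀ C₁ C₂ p t w)
    {q : ℕ} (hq : q ≤ m) {h : ℝ} (hh : h ∈ Set.Ioc (c / (pMin p : ℝ)) h₀) {x : Fin d → ℝ}
    (hx : x ∈ unitCube d) (f : (Fin d → ℝ) → ℝ) :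
    weightSum t w h x (cubeTaylor q f x) =
      if ∑ k, s k ≤ q then multiPartial s f x else 0 := by
  rw [weightSum_cubeTaylor, ← sum_taylorCoeff_ite]
  refine Finset.sum_congr rfl fun r hr => ?_
  rw [hw.reproduce h hh x hx r ((mem_multiIndices.1 hr).trans hq)]

/-- The right-hand side does not depend on the point `y`, so a polynomial of degree at most `|s|`
drops out of the increments of the functional. -/
theorem WeightCondition.weightSum_cubeTaylor_of_le (hw : WeightCondition s m c h₀ C₁ C₂ p t w)
    (hs : ∑ k, s k ≤ m) {q : ℕ} (hq : q ≤ ∑ k, s k) {h : ℝ}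
    (hh : h ∈ Set.Ioc (c / (pMin p : ℝ)) h₀) {y : Fin d → ℝ}
    (hy : y ∈ unitCube d) (x : Fin d → ℝ) (f : (Fin d → ℝ) → ℝ) :
    weightSum t w h y (cubeTaylor q f x) =
      if ∑ k, s k ≤ q then multiPartial s f x else 0 := by
  rw [weightSum_cubeTaylor, ← sum_taylorCoeff_ite]
  refine Finset.sum_congr rfl fun r hr => ?_
  rw [hw.reproduce_shift hs hh hy x ((mem_multiIndices.1 hr).trans hq)]

/-- The error of the linear functional for a function with Hölder top derivatives. -/
theorem WeightCondition.abs_weightSum_sub_le (hw : WeightCondition s m c h₀ C₁ C₂ p t w)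
    (ht : RegularDesign Cd p t) (hp : 1 ≤ pMin p) (hc : 0 < c) (hC₁ : 0 < C₁)
    {q : ℕ} (hq : q ≤ m) {h : ℝ} (hh : h ∈ Set.Ioc (c / (pMin p : ℝ)) h₀)
    {γ A : ℝ} (hγ : 0 < γ) (hA : 0 ≤ A) {f : (Fin d → ℝ) → ℝ} (hf : HolderTop q γ A f)
    {x : Fin d → ℝ} (hx : x ∈ unitCube d) :
    |weightSum t w h x f - if ∑ k, s k ≤ q then multiPartial s f x else 0| ≤
      windowConst d Cd c * C₁ * (d : ℝ) ^ q * A * (h ^ ((q : ℝ) + γ) / h ^ (∑ k, s k)) := by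
  have hh0 : 0 < h := lt_of_le_of_lt (by positivity) hh.1
  have hpp : (0 : ℝ) < pProd p := by exact_mod_cast pProd_pos hp
  -- In both cases the target is the functional at the Taylor polynomial, which vanishes when the
  -- degree is below `|s|`. Only the remainder is left to be weighted.
  rw [← hw.weightSum_cubeTaylor_self hq hh hx f]
  unfold weightSum
  rw [← Finset.sum_sub_distrib]
  refine (ht.abs_sum_le hc hp hh.1 hx
    (B := C₁ / ((pProd p : ℝ) * h ^ (d + ∑ k, s k)) *
      ((d : ℝ) ^ q * A * h ^ ((q : ℝ) + γ))) (by positivity) (fun j hj => ?_)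
      (fun j hj => ?_)).trans (le_of_eq ?_)
  · rw [← mul_sub, abs_mul]
    gcongr
    · exact hw.bounded h hh x hx j
    · refine (hf.abs_sub_cubeTaylor_le hγ hA hx (ht.designPoint_mem j)).trans ?_
      rw [norm_sub_rev]
      gcongr
  · rw [hw.localize h hh x hx j hj]; ring
  · rw [pow_add]; field_simp

/-- The increments of the linear functional at points closer than the bandwidth. -/
theorem WeightCondition.abs_weightSum_sub_weightSum_le
    (hw : WeightCondition s m c h₀ C₁ C₂ p t w)
    (ht : RegularDesign Cd p t) (hp : 1 ≤ pMin p) (hc : 0 < c) (hC₂ : 0 < C₂)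
    (hs : ∑ k, s k ≤ m) {q : ℕ} (hq : q ≤ ∑ k, s k) {h : ℝ}
    (hh : h ∈ Set.Ioc (c / (pMin p : ℝ)) h₀)
    {γ A : ℝ} (hγ : 0 < γ) (hA : 0 ≤ A) {f : (Fin d → ℝ) → ℝ} (hf : HolderTop q γ A f)
    {x y : Fin d → ℝ} (hx : x ∈ unitCube d) (hy : y ∈ unitCube d) (hxy : ‖x - y‖ ≤ h) :
    |weightSum t w h x f - weightSum t w h y f| ≤
      windowConst d Cd c * 2 ^ d * C₂ * (d : ℝ) ^ q * 2 ^ ((q : ℝ) + γ) * A *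
        (h ^ ((q : ℝ) + γ) / h ^ (∑ k, s k)) * (‖x - y‖ / h) := by
  have hh0 : 0 < h := lt_of_le_of_lt (by positivity) hh.1
  have hpp : (0 : ℝ) < pProd p := by exact_mod_cast pProd_pos hp
  -- Subtracting the same Taylor polynomial at `x` from both terms leaves weight differences, of
  -- relative size `‖x - y‖ / h`, times a remainder that is small near `x`.
  have h1 : weightSum t w h x f - weightSum t w h y f =
      ∑ j, (w h x j - w h y j) * (f (designPoint t j) - cubeTaylor q f x (designPoint t j)) := by
    have h2 : weightSum t w h x (cubeTaylor q f x) = weightSum t w h y (cubeTaylor q f x) := by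
      rw [hw.weightSum_cubeTaylor_of_le hs hq hh hx, hw.weightSum_cubeTaylor_of_le hs hq hh hy]
    have h3 : weightSum t w h x f - weightSum t w h y f =
      (weightSum t w h x f - weightSum t w h y f) -
        (weightSum t w h x (cubeTaylor q f x) - weightSum t w h y (cubeTaylor q f x)) := by
      rw [h2]; ring
    rw [h3]
    unfold weightSum
    rw [← Finset.sum_sub_distrib, ← Finset.sum_sub_distrib, ← Finset.sum_sub_distrib]
    exact Finset.sum_congr rfl fun j _ => by ring
  rw [h1]
  -- The weights at `y` live within `h` of `y`, hence within `2h` of `x`.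
  refine (ht.abs_sum_le hc hp (h := 2 * h) (by linarith [hh.1]) hx
    (B := C₂ / ((pProd p : ℝ) * h ^ (d + ∑ k, s k)) * (‖x - y‖ / h) *
      ((d : ℝ) ^ q * A * (2 * h) ^ ((q : ℝ) + γ))) (by positivity) (fun j hj => ?_)
      (fun j hj => ?_)).trans (le_of_eq ?_)
  · rw [abs_mul]
    gcongr
    · refine (hw.lipschitz h hh x hx y hy j).trans ?_
      gcongr
      exact min_le_left _ _
    · refine (hf.abs_sub_cubeTaylor_le hγ hA hx (ht.designPoint_mem j)).trans ?_
      rw [norm_sub_rev]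
      gcongr
  · rw [hw.localize h hh x hx j (by linarith), hw.localize h hh y hy j]
    · ring
    · have := norm_sub_le_norm_sub_add_norm_sub x y (designPoint t j)
      linarith
  · rw [pow_add, mul_pow, Real.mul_rpow (by norm_num) hh0.le]; field_simp

theorem abs_sub_le_add_of_abs_le {a b A B : ℝ} (ha : |a| ≤ A) (hb : |b| ≤ B) :
    |a - b| ≤ A + B := (abs_sub a b).trans (add_le_add ha hb)

/-- Uniform bounds for the linear functional on functions whose smoothness is below the order of
the derivative. -/
theorem WeightCondition.rough_bounds (hw : WeightCondition s m c h₀ C₁ C₂ p t w)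
    (ht : RegularDesign Cd p t) (hp : 1 ≤ pMin p) (hc : 0 < c) (hCd : 0 < Cd) (hC₁ : 0 < C₁)
    (hC₂ : 0 < C₂) (hs : ∑ k, s k ≤ m) {q : ℕ} (hq : q < ∑ k, s k) {h : ℝ}
    (hh : h ∈ Set.Ioc (c / (pMin p : ℝ)) h₀) {γ A η : ℝ} (hγ : 0 < γ) (hA : 0 ≤ A) (hη : 0 < η)
    (hη1 : η ≤ 1)
    {f : (Fin d → ℝ) → ℝ} (hf : HolderTop q γ A f) {K : ℝ}
    (hK : K = 2 * (windowConst d Cd c * C₁ * (d : ℝ) ^ q) +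
      windowConst d Cd c * 2 ^ d * C₂ * (d : ℝ) ^ q * 2 ^ ((q : ℝ) + γ)) :
    (∀ x ∈ unitCube d, |weightSum t w h x f| ≤ K * (h ^ ((q : ℝ) + γ) / h ^ (∑ k, s k)) * A) ∧
    ∀ x ∈ unitCube d, ∀ y ∈ unitCube d, |weightSum t w h x f - weightSum t w h y f| ≤
      K * (h ^ ((q : ℝ) + γ) / h ^ (∑ k, s k)) * A * (‖x - y‖ / h) ^ η := by
  have hh0 : 0 < h := lt_of_le_of_lt (by positivity) hh.1
  have hN := windowConst_pos (d := d) (c := c) hCd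
  set K₁ := windowConst d Cd c * C₁ * (d : ℝ) ^ q with hK₁
  set K₂ := windowConst d Cd c * 2 ^ d * C₂ * (d : ℝ) ^ q * 2 ^ ((q : ℝ) + γ) with hK₂
  have hK₁0 : 0 ≤ K₁ := by positivity
  have hK₂0 : 0 ≤ K₂ := by positivity
  set R := h ^ ((q : ℝ) + γ) / h ^ (∑ k, s k) with hR
  have hR0 : 0 ≤ R := by positivity
  have h1 : ∀ x ∈ unitCube d, |weightSum t w h x f| ≤ K₁ * A * R := fun x hx => by
    have := hw.abs_weightSum_sub_le ht hp hc hC₁ (by omega : q ≤ m) hh hγ hA hf hx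
    rwa [if_neg (by omega), sub_zero] at this
  have hAR : 0 ≤ A * R := by positivity
  refine ⟨fun x hx => (h1 x hx).trans ?_, fun x hx y hy => ?_⟩
  · rw [hK]; nlinarith
  -- Below the bandwidth the ratio `‖x - y‖ / h` is at most its power `η ≤ 1`; above it that power
  -- is at least one and twice the uniform bound suffices.
  · rcases le_or_gt ‖x - y‖ h with hxy | hxy
    · refine (hw.abs_weightSum_sub_weightSum_le ht hp hc hC₂ hs hq.le hh hγ hA hf hx hy
        hxy).trans ?_
      have h2 : ‖x - y‖ / h ≤ (‖x - y‖ / h) ^ η :=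
        Real.self_le_rpow_of_le_one (by positivity) ((div_le_one hh0).2 hxy) hη1
      calc K₂ * A * R * (‖x - y‖ / h) ≤ K₂ * A * R * (‖x - y‖ / h) ^ η := by gcongr
        _ ≤ K * R * A * (‖x - y‖ / h) ^ η := by
          gcongr ?_ * _
          rw [hK]; nlinarith
    · have h2 : 1 ≤ (‖x - y‖ / h) ^ η :=
        Real.one_le_rpow ((one_le_div hh0).2 hxy.le) hη.le
      calc _ ≤ K₁ * A * R + K₁ * A * R := abs_sub_le_add_of_abs_le (h1 x hx) (h1 y hy)
        _ ≤ K * R * A := by rw [hK]; nlinarith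
        _ ≤ _ := le_mul_of_one_le_right (by rw [hK]; positivity) h2

/-- Uniform bounds for the linear functional on functions whose smoothness exceeds the order of
the derivative. -/
theorem WeightCondition.smooth_bounds (hw : WeightCondition s m c h₀ C₁ C₂ p t w)
    (ht : RegularDesign Cd p t) (hp : 1 ≤ pMin p) (hc : 0 < c) (hCd : 0 < Cd) (hC₁ : 0 < C₁)
    (hC₂ : 0 < C₂) (hs : ∑ k, s k ≤ m) {q : ℕ} (hq : q = ∑ k, s k) {h : ℝ}
    (hh : h ∈ Set.Ioc (c / (pMin p : ℝ)) h₀) {γ A : ℝ} (hγ : 0 < γ) (hA : 0 ≤ A)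
    (hγ1 : γ ≤ 1) {f : (Fin d → ℝ) → ℝ} (hf : HolderTop q γ A f)
    (hfb : ∀ x ∈ unitCube d, |multiPartial s f x| ≤ A) {K : ℝ}
    (hK : K = 1 + (2 + h₀ ^ γ) * (windowConst d Cd c * C₁ * (d : ℝ) ^ q) +
      windowConst d Cd c * 2 ^ d * C₂ * (d : ℝ) ^ q * 2 ^ ((q : ℝ) + γ)) :
    (∀ x ∈ unitCube d, |weightSum t w h x f| ≤ K * A) ∧
    ∀ x ∈ unitCube d, ∀ y ∈ unitCube d, |weightSum t w h x f - weightSum t w h y f| ≤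
      K * A * ‖x - y‖ ^ γ := by
  have hh0 : 0 < h := lt_of_le_of_lt (by positivity) hh.1
  have hN := windowConst_pos (d := d) (c := c) hCd
  set K₁ := windowConst d Cd c * C₁ * (d : ℝ) ^ q with hK₁
  set K₂ := windowConst d Cd c * 2 ^ d * C₂ * (d : ℝ) ^ q * 2 ^ ((q : ℝ) + γ) with hK₂
  have hK₁0 : 0 ≤ K₁ := by positivity
  have hK₂0 : 0 ≤ K₂ := by positivity
  have hR : h ^ ((q : ℝ) + γ) / h ^ (∑ k, s k) = h ^ γ := by
    rw [← hq, Real.rpow_add hh0, Real.rpow_natCast]; field_simp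
  have h1 : ∀ x ∈ unitCube d, |weightSum t w h x f - multiPartial s f x| ≤ K₁ * A * h ^ γ :=
    fun x hx => by
    have := hw.abs_weightSum_sub_le ht hp hc hC₁ (by omega : q ≤ m) hh hγ hA hf hx
    rwa [if_pos (by omega), hR] at this
  have hh1 : h ^ γ ≤ h₀ ^ γ := Real.rpow_le_rpow hh0.le hh.2 hγ.le
  have hh2 : 0 ≤ h ^ γ := by positivity
  have hKA : 0 ≤ K₁ * A := by positivity
  have hKA2 : 0 ≤ K₂ * A := by positivity
  have hh3 : K₁ * A * h ^ γ ≤ K₁ * A * h₀ ^ γ := by gcongr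
  refine ⟨fun x hx => ?_, fun x hx y hy => ?_⟩
  · have h2 := abs_sub_abs_le_abs_sub (weightSum t w h x f) (multiPartial s f x)
    have h3 := h1 x hx
    have h4 := hfb x hx
    rw [hK]; nlinarith
  -- Below the bandwidth the factor `h ^ γ` cancels the denominator of `(‖x - y‖ / h) ^ γ`. Above it
  -- both values are compared with `∂^s f`, at a cost `h ^ γ ≤ ‖x - y‖ ^ γ`.
  · rcases le_or_gt ‖x - y‖ h with hxy | hxy
    · have h2 := hw.abs_weightSum_sub_weightSum_le ht hp hc hC₂ hs hq.le hh hγ hA hf hx hy hxy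
      rw [hR] at h2
      refine h2.trans ?_
      have h3 : ‖x - y‖ / h ≤ (‖x - y‖ / h) ^ γ :=
        Real.self_le_rpow_of_le_one (by positivity) ((div_le_one hh0).2 hxy) hγ1
      calc K₂ * A * h ^ γ * (‖x - y‖ / h) ≤ K₂ * A * h ^ γ * (‖x - y‖ / h) ^ γ := by gcongr
        _ = K₂ * A * ‖x - y‖ ^ γ := by
          rw [Real.div_rpow (norm_nonneg _) hh0.le]
          have : h ^ γ ≠ 0 := by positivity
          field_simp
        _ ≤ _ := by
          gcongr
          rw [hK]
          have : 0 ≤ (2 + h₀ ^ γ) * K₁ := mul_nonneg (by linarith) hK₁0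
          linarith
    · have h2 : h ^ γ ≤ ‖x - y‖ ^ γ := Real.rpow_le_rpow hh0.le hxy.le hγ.le
      have h3 : |multiPartial s f x - multiPartial s f y| ≤ A * ‖x - y‖ ^ γ :=
        hf.holder s hq.symm x hx y hy
      have h4 := abs_sub_le_add_of_abs_le (h1 x hx) (h1 y hy)
      have h5 : weightSum t w h x f - weightSum t w h y f =
        (weightSum t w h x f - multiPartial s f x - (weightSum t w h y f - multiPartial s f y)) +
          (multiPartial s f x - multiPartial s f y) := by ring
      rw [h5]
      refine (abs_add_le _ _).trans ?_
      have h6 : K₁ * A * h ^ γ ≤ K₁ * A * ‖x - y‖ ^ γ := by gcongr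
      have h7 : 0 ≤ ‖x - y‖ ^ γ := by positivity
      calc _ ≤ (2 * K₁ + 1) * A * ‖x - y‖ ^ γ := by linarith
        _ ≤ _ := by
          gcongr
          rw [hK]
          have : 0 ≤ h₀ ^ γ * K₁ := mul_nonneg (by linarith) hK₁0
          linarith

end Weights

/-! ### Symmetrization and maximal inequalities over finite index sets. -/

section MaximalInequalities

/-- A smooth upper bound for the sup-norm. -/
theorem pi_norm_le_exp_sum {V : Type*} [Fintype V] (y : V → ℝ) {l Λ : ℝ} (hl : 0 < l)
    (hΛ : 0 ≤ Λ) :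
    ‖y‖ ≤ 1 / l * (Λ + Real.exp (-Λ) * ∑ v, (Real.exp (l * y v) + Real.exp (-(l * y v)))) := by
  have h0 : ∀ v, 0 ≤ Real.exp (l * y v) + Real.exp (-(l * y v)) := fun v => by positivity
  refine (pi_norm_le_iff_of_nonneg (mul_nonneg (by positivity) (add_nonneg hΛ
    (mul_nonneg (Real.exp_pos _).le (Finset.sum_nonneg fun v _ => h0 v))))).2 fun v => ?_
  rw [Real.norm_eq_abs, one_div, ← div_eq_inv_mul, le_div_iff₀ hl]
  have h1 : Real.exp (l * |y v|) ≤ Real.exp (l * y v) + Real.exp (-(l * y v)) := by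
    rcases abs_cases (y v) with ⟨h, _⟩ | ⟨h, _⟩ <;> rw [h]
    · linarith [Real.exp_pos (-(l * y v))]
    · rw [mul_neg]; linarith [Real.exp_pos (l * y v)]
  have h2 : Real.exp (l * |y v|) ≤ ∑ v, (Real.exp (l * y v) + Real.exp (-(l * y v))) :=
    h1.trans (Finset.single_le_sum (f := fun v => Real.exp (l * y v) + Real.exp (-(l * y v)))
      (fun v _ => h0 v) (Finset.mem_univ v))
  -- The tangent `u + 1 ≤ exp u` replaces the logarithm of the usual soft maximum, so that
  -- expectations can later be taken term by term.
  have h3 := Real.add_one_le_exp (l * |y v| - Λ)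
  rw [sub_eq_add_neg, Real.exp_add] at h3
  have h4 : Real.exp (l * |y v|) * Real.exp (-Λ) ≤ Real.exp (-Λ) *
      ∑ v, (Real.exp (l * y v) + Real.exp (-(l * y v))) := by
    rw [mul_comm]; gcongr
  linarith

/-- The logarithmic size of a finite index set, bounded away from zero. -/
noncomputable def logSize (V : Type*) [Fintype V] : ℝ := Real.log (Fintype.card V) + 2

theorem logSize_ge_two (V : Type*) [Fintype V] [Nonempty V] : 2 ≤ logSize V := by
  have : 0 ≤ Real.log (Fintype.card V) :=
    Real.log_nonneg (by exact_mod_cast Fintype.card_pos)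
  unfold logSize; linarith

/-- The choice `Λ = log |V| + u` reduces the exponential term to `2`, the origin of the summand `2`
in `logSize`. -/
theorem exp_neg_mul_card_le (V : Type*) [Fintype V] [Nonempty V] (u : ℝ) :
    (Real.log (Fintype.card V) + u) + Real.exp (-(Real.log (Fintype.card V) + u)) *
      (Fintype.card V * (2 * Real.exp u)) = logSize V + u := by
  have hV : (0 : ℝ) < Fintype.card V := by exact_mod_cast Fintype.card_pos
  rw [neg_add, Real.exp_add, Real.exp_neg, Real.exp_log hV, Real.exp_neg]
  unfold logSize
  have := Real.exp_pos u
  field_simp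
  ring

/-- The sign `±1` of a Boolean. -/
def boolSign (b : Bool) : ℝ := if b then 1 else -1

/-- The sum factorizes over the coordinates into `2 cosh (u i)`, and `cosh u ≤ exp (u² / 2)`. -/
theorem sum_exp_boolSign {n : ℕ} (u : Fin n → ℝ) :
    ∑ σ : Fin n → Bool, Real.exp (∑ i, boolSign (σ i) * u i) ≤
      2 ^ n * Real.exp ((∑ i, u i ^ 2) / 2) := by
  have h1 : ∑ σ : Fin n → Bool, Real.exp (∑ i, boolSign (σ i) * u i) =
      ∏ i, ∑ b : Bool, Real.exp (boolSign b * u i) := by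
    rw [Finset.prod_univ_sum, Fintype.piFinset_univ]
    exact Finset.sum_congr rfl fun σ _ => Real.exp_sum _ _
  have h2 : (2 : ℝ) ^ n * Real.exp ((∑ i, u i ^ 2) / 2) =
      ∏ i, (2 * Real.exp (u i ^ 2 / 2)) := by
    rw [Finset.prod_mul_distrib, Finset.prod_const, Finset.card_univ, Fintype.card_fin,
      Finset.sum_div, Real.exp_sum]
  rw [h1, h2]
  refine Finset.prod_le_prod (fun i _ => Finset.sum_nonneg fun b _ => (Real.exp_pos _).le)
    fun i _ => ?_
  have h3 := Real.cosh_le_exp_half_sq (u i)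
  rw [Real.cosh_eq] at h3
  simp only [Fintype.sum_bool, boolSign, if_true]
  simp only [Bool.false_eq_true, if_false, one_mul, neg_one_mul]
  linarith

/-- The average over signs of the sup-norm of a signed sum. -/
theorem sum_boolSign_norm_le {n : ℕ} {V : Type*} [Fintype V] [Nonempty V] (x : Fin n → V → ℝ)
    {a : Fin n → ℝ} (hxa : ∀ i, ‖x i‖ ≤ a i) {l : ℝ} (hl : 0 < l) :
    ∑ σ : Fin n → Bool, ‖∑ i, boolSign (σ i) • x i‖ ≤
      2 ^ n * (1 / l * (logSize V + l ^ 2 * (∑ i, a i ^ 2) / 2)) := by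
  set u := l ^ 2 * (∑ i, a i ^ 2) / 2 with hu
  have hu0 : 0 ≤ u := by
    have : 0 ≤ ∑ i, a i ^ 2 := Finset.sum_nonneg fun _ _ => sq_nonneg _
    positivity
  set Λ := Real.log (Fintype.card V) + u with hΛ
  have hΛ0 : 0 ≤ Λ := add_nonneg
    (Real.log_nonneg (by exact_mod_cast Fintype.card_pos)) hu0
  have key : ∀ (v : V) (e : ℝ), e ^ 2 = 1 → ∑ σ : Fin n → Bool,
      Real.exp (e * (l * (∑ i, boolSign (σ i) • x i) v)) ≤ 2 ^ n * Real.exp u := by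
    intro v e he
    have h1 : ∀ σ : Fin n → Bool, e * (l * (∑ i, boolSign (σ i) • x i) v) =
        ∑ i, boolSign (σ i) * (e * (l * x i v)) := fun σ => by
      rw [Finset.sum_apply, Finset.mul_sum, Finset.mul_sum]
      refine Finset.sum_congr rfl fun i _ => ?_
      rw [Pi.smul_apply, smul_eq_mul]; ring
    simp_rw [h1]
    refine (sum_exp_boolSign _).trans ?_
    gcongr
    rw [hu, mul_div_assoc, mul_div_assoc', Finset.mul_sum]
    gcongr with i
    rw [mul_pow, mul_pow, he, one_mul]
    gcongr 1
    have h2 := (norm_le_pi_norm (x i) v).trans (hxa i)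
    rw [Real.norm_eq_abs] at h2
    exact sq_le_sq' (by linarith [neg_abs_le (x i v)]) ((le_abs_self _).trans h2)
  calc ∑ σ : Fin n → Bool, ‖∑ i, boolSign (σ i) • x i‖
      ≤ ∑ σ : Fin n → Bool, 1 / l * (Λ + Real.exp (-Λ) *
        ∑ v, (Real.exp (l * (∑ i, boolSign (σ i) • x i) v) +
          Real.exp (-(l * (∑ i, boolSign (σ i) • x i) v)))) :=
        Finset.sum_le_sum fun σ _ => pi_norm_le_exp_sum _ hl hΛ0
    _ = 1 / l * (2 ^ n * Λ + Real.exp (-Λ) * ∑ v, ∑ σ : Fin n → Bool,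
        (Real.exp (l * (∑ i, boolSign (σ i) • x i) v) +
          Real.exp (-(l * (∑ i, boolSign (σ i) • x i) v)))) := by
      rw [← Finset.mul_sum, Finset.sum_add_distrib, ← Finset.mul_sum, Finset.sum_comm]
      simp
    _ ≤ 1 / l * (2 ^ n * Λ + Real.exp (-Λ) * ∑ _v : V, 2 ^ n * (2 * Real.exp u)) := by
      gcongr with v _
      rw [Finset.sum_add_distrib]
      have h1 := key v 1 (by norm_num)
      have h2 := key v (-1) (by norm_num)
      simp only [one_mul, neg_one_mul] at h1 h2
      linarith
    _ = 2 ^ n * (1 / l * (Λ + Real.exp (-Λ) * (Fintype.card V * (2 * Real.exp u)))) := by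
      rw [Finset.sum_const, Finset.card_univ, nsmul_eq_mul]; ring
    _ = _ := by rw [hΛ, exp_neg_mul_card_le]

variable {Ω : Type*} [MeasurableSpace Ω] {P : Measure Ω} [IsProbabilityMeasure P]

/-- Jensen's inequality given `U`: each `u` is the mean of `u + W`. Independence lets this be
carried out under the product of the two laws. -/
theorem integral_norm_le_integral_norm_add {E : Type*} [NormedAddCommGroup E] [NormedSpace ℝ E]
    [MeasurableSpace E] [BorelSpace E] [SecondCountableTopology E] [CompleteSpace E]
    {U W : Ω → E} (hU : Measurable U) (hW : Measurable W) (hUi : Integrable U P)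
    (hWi : Integrable W P) (hUW : IndepFun U W P) (hW0 : ∫ ω, W ω ∂P = 0) :
    ∫ ω, ‖U ω‖ ∂P ≤ ∫ ω, ‖U ω + W ω‖ ∂P := by
  have := Measure.isProbabilityMeasure_map (μ := P) hU.aemeasurable
  have := Measure.isProbabilityMeasure_map (μ := P) hW.aemeasurable
  have hmap := (indepFun_iff_map_prod_eq_prod_map_map hU.aemeasurable hW.aemeasurable).1 hUW
  have hcont : Measurable fun z : E × E => z.1 + z.2 := by fun_prop
  have hint : Integrable (fun z : E × E => z.1 + z.2) ((P.map U).prod (P.map W)) := by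
    rw [← hmap, integrable_map_measure hcont.aestronglyMeasurable (by fun_prop)]
    exact hUi.add hWi
  have hU1 : Integrable (fun u : E => u) (P.map U) :=
    (integrable_map_measure measurable_id.aestronglyMeasurable hU.aemeasurable).2 hUi
  have hW1 : Integrable (fun u : E => u) (P.map W) :=
    (integrable_map_measure measurable_id.aestronglyMeasurable hW.aemeasurable).2 hWi
  have hW2 : ∫ v, v ∂(P.map W) = 0 :=
    (integral_map hW.aemeasurable measurable_id.aestronglyMeasurable).trans hW0
  calc ∫ ω, ‖U ω‖ ∂P = ∫ u, ‖u‖ ∂(P.map U) := by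
        rw [integral_map hU.aemeasurable (by fun_prop)]
    _ ≤ ∫ u, ∫ v, ‖u + v‖ ∂(P.map W) ∂(P.map U) := by
      refine integral_mono_ae hU1.norm hint.norm.integral_prod_left (ae_of_all _ fun u => ?_)
      have h1 : ∫ v, (u + v) ∂(P.map W) = u := by
        rw [integral_add (integrable_const u) hW1, hW2]
        simp
      calc ‖u‖ = ‖∫ v, (u + v) ∂(P.map W)‖ := by rw [h1]
        _ ≤ _ := norm_integral_le_integral_norm _
    _ = ∫ z, ‖z.1 + z.2‖ ∂((P.map U).prod (P.map W)) := (integral_prod _ hint.norm).symm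
    _ = ∫ ω, ‖U ω + W ω‖ ∂P := by
      rw [← hmap, integral_map (by fun_prop) hcont.norm.aestronglyMeasurable]

/-- Symmetrization by a fixed pattern of signs. -/
theorem integral_norm_sum_le_two_mul_boolSign {E : Type*} [NormedAddCommGroup E]
    [NormedSpace ℝ E] [MeasurableSpace E] [BorelSpace E] [SecondCountableTopology E]
    [CompleteSpace E] {n : ℕ} {X : Fin n → Ω → E} (hm : ∀ i, Measurable (X i))
    (hint : ∀ i, Integrable (X i) P) (hind : iIndepFun X P) (h0 : ∀ i, ∫ ω, X i ω ∂P = 0)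
    (σ : Fin n → Bool) :
    ∫ ω, ‖∑ i, X i ω‖ ∂P ≤ 2 * ∫ ω, ‖∑ i, boolSign (σ i) • X i ω‖ ∂P := by
  -- With `U` and `W` the sums over the positive and the negative signs, both `E‖U‖` and `E‖W‖` are
  -- at most `E‖U - W‖`; this gives the factor two.
  set S : Finset (Fin n) := Finset.univ.filter fun i => σ i = true with hS
  set T : Finset (Fin n) := Finset.univ.filter fun i => ¬ σ i = true with hT
  have hST : Disjoint S T := Finset.disjoint_filter_filter_not _ _ _
  set U : Ω → E := fun ω => ∑ i ∈ S, X i ω with hU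
  set W : Ω → E := fun ω => ∑ i ∈ T, X i ω with hW
  have hsum : ∀ ω, ∑ i, X i ω = U ω + W ω := fun ω =>
    (Finset.sum_filter_add_sum_filter_not _ _ _).symm
  have hsgn : ∀ ω, ∑ i, boolSign (σ i) • X i ω = U ω + -W ω := fun ω => by
    rw [← Finset.sum_filter_add_sum_filter_not Finset.univ (fun i => σ i = true), hU, hW,
      ← Finset.sum_neg_distrib]
    congr 1
    · exact Finset.sum_congr rfl fun i hi => by
        simp [boolSign, (Finset.mem_filter.1 hi).2]
    · exact Finset.sum_congr rfl fun i hi => by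
        simp [boolSign, (Finset.mem_filter.1 hi).2]
  have hUm : Measurable U := Finset.measurable_fun_sum _ fun i _ => hm i
  have hWm : Measurable W := Finset.measurable_fun_sum _ fun i _ => hm i
  have hUi : Integrable U P := integrable_finsetSum _ fun i _ => hint i
  have hWi : Integrable W P := integrable_finsetSum _ fun i _ => hint i
  have hU0 : ∫ ω, U ω ∂P = 0 := by
    rw [hU, integral_finsetSum _ fun i _ => hint i]
    exact Finset.sum_eq_zero fun i _ => h0 i
  have hW0 : ∫ ω, W ω ∂P = 0 := by
    rw [hW, integral_finsetSum _ fun i _ => hint i]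
    exact Finset.sum_eq_zero fun i _ => h0 i
  have hUW : IndepFun U W P := by
    have h1 := hind.indepFun_finset S T hST hm
    have h2 := h1.comp (φ := fun f : S → E => ∑ i, f i) (ψ := fun f : T → E => ∑ i, f i)
      (Finset.measurable_fun_sum _ fun i _ => measurable_pi_apply i)
      (Finset.measurable_fun_sum _ fun i _ => measurable_pi_apply i)
    have e1 : (fun f : S → E => ∑ i, f i) ∘ (fun ω (i : S) => X i ω) = U := by
      ext ω; exact Finset.sum_coe_sort S fun i => X i ω
    have e2 : (fun f : T → E => ∑ i, f i) ∘ (fun ω (i : T) => X i ω) = W := by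
      ext ω; exact Finset.sum_coe_sort T fun i => X i ω
    rwa [e1, e2] at h2
  have hA : ∫ ω, ‖U ω‖ ∂P ≤ ∫ ω, ‖U ω + -W ω‖ ∂P :=
    integral_norm_le_integral_norm_add hUm hWm.neg hUi hWi.neg
      (hUW.comp measurable_id measurable_neg) ((integral_neg W).trans (by rw [hW0, neg_zero]))
  have hB : ∫ ω, ‖W ω‖ ∂P ≤ ∫ ω, ‖U ω + -W ω‖ ∂P := by
    have := integral_norm_le_integral_norm_add hWm hUm.neg hWi hUi.neg
      (hUW.symm.comp measurable_id measurable_neg) ((integral_neg U).trans (by rw [hU0, neg_zero]))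
    refine this.trans (le_of_eq (integral_congr_ae (ae_of_all _ fun ω => ?_)))
    change ‖W ω + -U ω‖ = ‖U ω + -W ω‖
    rw [← norm_neg (U ω + -W ω)]
    congr 1
    abel
  simp_rw [hsum, hsgn]
  calc ∫ ω, ‖U ω + W ω‖ ∂P ≤ ∫ ω, (‖U ω‖ + ‖W ω‖) ∂P :=
        integral_mono (hUi.add hWi).norm (hUi.norm.add hWi.norm) fun ω => norm_add_le _ _
    _ = ∫ ω, ‖U ω‖ ∂P + ∫ ω, ‖W ω‖ ∂P := integral_add hUi.norm hWi.norm
    _ ≤ _ := by linarith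

/-- At `l = √ℓ / τ` the two terms are `τ √ℓ` and half of it, which is the optimal order. -/
theorem optimal_exponent {ℓ τ : ℝ} (hℓ : 0 < ℓ) (hτ : 0 < τ) :
    1 / (√ℓ / τ) * (ℓ + (√ℓ / τ) ^ 2 * τ ^ 2 / 2) = 3 / 2 * (τ * √ℓ) := by
  have h1 : √ℓ ≠ 0 := (Real.sqrt_pos.2 hℓ).ne'
  have h2 : (√ℓ / τ) ^ 2 * τ ^ 2 = ℓ := by
    rw [div_pow, Real.sq_sqrt hℓ.le]; field_simp
  rw [h2]
  field_simp
  rw [Real.sq_sqrt hℓ.le]; ring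

/-- Maximal inequality for sums of independent centred random vectors with square integrable
envelopes. -/
theorem integral_norm_sum_le {n : ℕ} {V : Type*} [Fintype V] [Nonempty V]
    {X : Fin n → Ω → V → ℝ} (hm : ∀ i, Measurable (X i))
    (hint : ∀ i, Integrable (X i) P) (hind : iIndepFun X P) (h0 : ∀ i, ∫ ω, X i ω ∂P = 0)
    {a : Fin n → Ω → ℝ} (ha : ∀ i, Integrable (fun ω => a i ω ^ 2) P)
    (hXa : ∀ i, ∀ᵐ ω ∂P, ‖X i ω‖ ≤ a i ω) {τ : ℝ} (hτ : 0 < τ)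
    (hsum : ∑ i, ∫ ω, a i ω ^ 2 ∂P ≤ τ ^ 2) :
    ∫ ω, ‖∑ i, X i ω‖ ∂P ≤ 3 * (τ * √(logSize V)) := by
  have hℓ : 0 < logSize V := by linarith [logSize_ge_two V]
  set l := √(logSize V) / τ with hl
  have hl0 : 0 < l := div_pos (Real.sqrt_pos.2 hℓ) hτ
  have hI : ∀ σ : Fin n → Bool, Integrable (fun ω => ‖∑ i, boolSign (σ i) • X i ω‖) P :=
    fun σ => Integrable.norm (f := fun ω => ∑ i, boolSign (σ i) • X i ω)
      (integrable_finsetSum _ fun i _ => (hint i).smul (boolSign (σ i)))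
  have ha' : Integrable (fun ω => ∑ i, a i ω ^ 2) P := integrable_finsetSum _ fun i _ => ha i
  -- Averaging the inequality for fixed signs over all `2 ^ n` patterns is Rademacher symmetrization
  -- without enlarging the probability space; the sign average is then bounded for each `ω`.
  have h1 : 2 ^ n * ∫ ω, ‖∑ i, X i ω‖ ∂P ≤
      2 * ∫ ω, ∑ σ : Fin n → Bool, ‖∑ i, boolSign (σ i) • X i ω‖ ∂P := by
    have h5 : ∑ _σ : Fin n → Bool, ∫ ω, ‖∑ i, X i ω‖ ∂P = 2 ^ n * ∫ ω, ‖∑ i, X i ω‖ ∂P := by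
      rw [Finset.sum_const, nsmul_eq_mul, Finset.card_univ, Fintype.card_fun, Fintype.card_bool,
        Fintype.card_fin]
      push_cast; rfl
    rw [← h5, integral_finsetSum _ fun σ _ => hI σ, Finset.mul_sum]
    exact Finset.sum_le_sum fun σ _ =>
      integral_norm_sum_le_two_mul_boolSign hm hint hind h0 σ
  have ha2 : Integrable (fun ω => l ^ 2 * (∑ i, a i ω ^ 2) / 2) P :=
    (ha'.const_mul _).div_const _
  have h2 : ∫ ω, ∑ σ : Fin n → Bool, ‖∑ i, boolSign (σ i) • X i ω‖ ∂P ≤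
      ∫ ω, 2 ^ n * (1 / l * (logSize V + l ^ 2 * (∑ i, a i ω ^ 2) / 2)) ∂P := by
    refine integral_mono_ae (integrable_finsetSum _ fun σ _ => hI σ)
      ((((integrable_const _).add ha2).const_mul _).const_mul _) ?_
    filter_upwards [ae_all_iff.2 hXa] with ω hω
    exact sum_boolSign_norm_le (fun i => X i ω) hω hl0
  have h3 : ∫ ω, 2 ^ n * (1 / l * (logSize V + l ^ 2 * (∑ i, a i ω ^ 2) / 2)) ∂P =
      2 ^ n * (1 / l * (logSize V + l ^ 2 * (∑ i, ∫ ω, a i ω ^ 2 ∂P) / 2)) := by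
    rw [integral_const_mul, integral_const_mul, integral_add (integrable_const _) ha2,
      integral_div, integral_const_mul, integral_finsetSum _ fun i _ => ha i, integral_const,
      probReal_univ, one_smul]
  have h4 : 1 / l * (logSize V + l ^ 2 * (∑ i, ∫ ω, a i ω ^ 2 ∂P) / 2) ≤
      3 / 2 * (τ * √(logSize V)) := by
    rw [← optimal_exponent hℓ hτ]
    gcongr
  have h6 : (0 : ℝ) < 2 ^ n := by positivity
  refine le_of_mul_le_mul_left ?_ h6
  calc 2 ^ n * ∫ ω, ‖∑ i, X i ω‖ ∂P ≤ 2 * (2 ^ n * (3 / 2 * (τ * √(logSize V)))) := by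
        refine h1.trans (mul_le_mul_of_nonneg_left (h2.trans ?_) zero_le_two)
        rw [h3]
        exact mul_le_mul_of_nonneg_left h4 h6.le
    _ = _ := by ring

/-- Maximal inequality for sub-Gaussian random variables. -/
theorem integral_norm_le_of_subgaussian {V : Type*} [Fintype V] [Nonempty V]
    {Y : V → Ω → ℝ} {κ : V → NNReal} (hY : ∀ v, HasSubgaussianMGF (Y v) (κ v) P) {τ : ℝ}
    (hτ : 0 < τ) (hκ : ∀ v, (κ v : ℝ) ≤ τ ^ 2) :
    Integrable (fun ω => ‖fun v => Y v ω‖) P ∧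
      ∫ ω, ‖fun v => Y v ω‖ ∂P ≤ 3 / 2 * (τ * √(logSize V)) := by
  have hℓ : 0 < logSize V := by linarith [logSize_ge_two V]
  set l := √(logSize V) / τ with hl
  have hl0 : 0 < l := div_pos (Real.sqrt_pos.2 hℓ) hτ
  have hI : Integrable (fun ω => ‖fun v => Y v ω‖) P :=
    (Integrable.of_eval fun v => (hY v).integrable).norm
  refine ⟨hI, ?_⟩
  set u := l ^ 2 * τ ^ 2 / 2 with hu
  set Λ := Real.log (Fintype.card V) + u with hΛ
  have hΛ0 : 0 ≤ Λ := add_nonneg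
    (Real.log_nonneg (by exact_mod_cast Fintype.card_pos)) (by positivity)
  have he : ∀ v, Integrable (fun ω => Real.exp (l * Y v ω) + Real.exp (-(l * Y v ω))) P :=
    fun v => by
    have h1 := (hY v).integrable_exp_mul l
    have h2 := (hY v).integrable_exp_mul (-l)
    simp_rw [neg_mul] at h2
    exact h1.add h2
  have hv : ∀ v, ∫ ω, (Real.exp (l * Y v ω) + Real.exp (-(l * Y v ω))) ∂P ≤
      2 * Real.exp u := fun v => by
    have h1 := (hY v).integrable_exp_mul l
    have h2 := (hY v).integrable_exp_mul (-l)
    have h3 := (hY v).mgf_le l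
    have h4 := (hY v).mgf_le (-l)
    unfold mgf at h3 h4
    simp_rw [neg_mul] at h2 h4
    rw [integral_add h1 h2]
    have h5 : (κ v : ℝ) * l ^ 2 / 2 ≤ u := by
      rw [hu, mul_comm (l ^ 2)]
      have := hκ v
      gcongr
    have h6 := Real.exp_le_exp.2 h5
    rw [neg_sq] at h4
    linarith
  calc ∫ ω, ‖fun v => Y v ω‖ ∂P
      ≤ ∫ ω, 1 / l * (Λ + Real.exp (-Λ) *
          ∑ v, (Real.exp (l * Y v ω) + Real.exp (-(l * Y v ω)))) ∂P := by
        refine integral_mono hI ?_ fun ω => pi_norm_le_exp_sum _ hl0 hΛ0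
        exact ((integrable_const _).add
          ((integrable_finsetSum _ fun v _ => he v).const_mul _)).const_mul _
    _ = 1 / l * (Λ + Real.exp (-Λ) *
          ∑ v, ∫ ω, (Real.exp (l * Y v ω) + Real.exp (-(l * Y v ω))) ∂P) := by
      rw [integral_const_mul, integral_add (integrable_const _)
        ((integrable_finsetSum _ fun v _ => he v).const_mul _), integral_const_mul,
        integral_finsetSum _ fun v _ => he v]
      simp
    _ ≤ 1 / l * (Λ + Real.exp (-Λ) * ∑ _v : V, 2 * Real.exp u) := by
      gcongr with v
      exact hv v
    _ = 1 / l * (logSize V + u) := by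
      rw [← exp_neg_mul_card_le V u, Finset.sum_const, Finset.card_univ, nsmul_eq_mul]
    _ = _ := by rw [hu, optimal_exponent hℓ hτ]

end MaximalInequalities

/-! ### Dyadic chaining on the cube. -/

section Chaining

variable {d : ℕ}

/-- Rounding down to the grid of mesh `1 / N`. -/
noncomputable def gridRound (N : ℕ) (x : Fin d → ℝ) : Fin d → ℝ := fun k => (⌊N * x k⌋₊ : ℝ) / N

/-- The points of the grid of mesh `1 / N` in the unit cube. -/
noncomputable def gridPoint (N : ℕ) (v : Fin d → Fin (N + 1)) : Fin d → ℝ :=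
  fun k => ((v k : ℕ) : ℝ) / N

theorem gridPoint_mem {N : ℕ} (hN : 1 ≤ N) (v : Fin d → Fin (N + 1)) :
    gridPoint N v ∈ unitCube d := by
  refine mem_unitCube.2 fun k => ⟨by unfold gridPoint; positivity, ?_⟩
  have hN' : (0 : ℝ) < N := by exact_mod_cast hN
  unfold gridPoint
  rw [div_le_one hN']
  exact_mod_cast Nat.lt_succ_iff.1 (v k).2

theorem exists_gridPoint_eq {N : ℕ} {x : Fin d → ℝ} (hx : x ∈ unitCube d) :
    ∃ v : Fin d → Fin (N + 1), gridPoint N v = gridRound N x := by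
  -- The value `N` is attained at `x k = 1`, hence `N + 1` grid values per coordinate.
  refine ⟨fun k => ⟨⌊N * x k⌋₊, Nat.lt_succ_iff.2 ?_⟩, rfl⟩
  refine Nat.floor_le_of_le ?_
  exact mul_le_of_le_one_right (Nat.cast_nonneg N) ((mem_unitCube.1 hx k).2)

theorem gridRound_mem {N : ℕ} (hN : 1 ≤ N) {x : Fin d → ℝ} (hx : x ∈ unitCube d) :
    gridRound N x ∈ unitCube d := by
  obtain ⟨v, hv⟩ := exists_gridPoint_eq (N := N) hx
  exact hv ▸ gridPoint_mem hN v

theorem norm_sub_gridRound_le {N : ℕ} (hN : 1 ≤ N) {x : Fin d → ℝ} (hx : x ∈ unitCube d) :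
    ‖x - gridRound N x‖ ≤ 1 / N := by
  have hN' : (0 : ℝ) < N := by exact_mod_cast hN
  refine (pi_norm_le_iff_of_nonneg (by positivity)).2 fun k => ?_
  have h0 : 0 ≤ N * x k := mul_nonneg hN'.le (mem_unitCube.1 hx k).1
  have h1 := Nat.floor_le h0
  have h2 := (Nat.lt_floor_add_one (N * x k)).le
  have h3 : x k - gridRound N x k = (N * x k - ⌊N * x k⌋₊) / N := by
    unfold gridRound; field_simp
  rw [Pi.sub_apply, Real.norm_eq_abs, h3, abs_of_nonneg (div_nonneg (by linarith) hN'.le)]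
  gcongr
  linarith

/-- Rounding down is nested across dyadic levels, so the coarse point of a link is a function of the
fine one and a link takes no more values than the fine grid has points. -/
theorem gridRound_gridRound (l : ℕ) (x : Fin d → ℝ) :
    gridRound (2 ^ l) (gridRound (2 ^ (l + 1)) x) = gridRound (2 ^ l) x := by
  ext k
  unfold gridRound
  congr 2
  have h1 : ((2 ^ l : ℕ) : ℝ) * ((⌊((2 ^ (l + 1) : ℕ) : ℝ) * x k⌋₊ : ℝ) / ((2 ^ (l + 1) : ℕ) : ℝ)) =
      (⌊((2 ^ (l + 1) : ℕ) : ℝ) * x k⌋₊ : ℝ) / ((2 : ℕ) : ℝ) := by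
    push_cast; rw [pow_succ]; field_simp
  have h2 : ((2 ^ l : ℕ) : ℝ) * x k = (((2 ^ (l + 1) : ℕ) : ℝ) * x k) / ((2 : ℕ) : ℝ) := by
    push_cast; rw [pow_succ]; field_simp
  rw [h1, h2, Nat.floor_div_eq_div, Nat.floor_div_natCast]

theorem logSize_grid (N : ℕ) : logSize (Fin d → Fin (N + 1)) = d * Real.log (N + 1) + 2 := by
  unfold logSize
  rw [Fintype.card_fun, Fintype.card_fin, Fintype.card_fin]
  push_cast
  rw [Real.log_pow]

/-- The square root is discarded: linear growth in the level is enough against geometrically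
decaying increments. -/
theorem sqrt_logSize_dyadic_le (l : ℕ) :
    √(logSize (Fin d → Fin (2 ^ l + 1))) ≤ (d + 2) * (l + 1) := by
  have h1 : logSize (Fin d → Fin (2 ^ l + 1)) ≤ (d + 2) * (l + 1) := by
    rw [logSize_grid]
    have h2 : Real.log (((2 ^ l : ℕ) : ℝ) + 1) ≤ l + 1 := by
      have h3 : ((2 ^ l : ℕ) : ℝ) + 1 ≤ 2 ^ (l + 1) := by
        push_cast; rw [pow_succ]
        have : (1 : ℝ) ≤ 2 ^ l := one_le_pow₀ (by norm_num)
        linarith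
      have h5 : Real.log (2 : ℝ) ≤ 1 := by linarith [Real.log_two_lt_d9]
      calc _ ≤ Real.log (2 ^ (l + 1)) := Real.log_le_log (by positivity) h3
        _ = (l + 1) * Real.log 2 := by rw [Real.log_pow]; push_cast; ring
        _ ≤ (l + 1) * 1 := by gcongr
        _ = l + 1 := mul_one _
    have : (d : ℝ) * Real.log (((2 ^ l : ℕ) : ℝ) + 1) ≤ d * (l + 1) := by gcongr
    have hl : (0 : ℝ) ≤ l := Nat.cast_nonneg l
    nlinarith
  refine (Real.sqrt_le_sqrt h1).trans ?_
  rw [Real.sqrt_le_left (by positivity)]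
  have h6 : (1 : ℝ) ≤ (d + 2) * (l + 1) := by
    have hl : (0 : ℝ) ≤ l := Nat.cast_nonneg l
    have hd : (0 : ℝ) ≤ d := Nat.cast_nonneg d
    nlinarith
  nlinarith

variable {Ω : Type*} [MeasurableSpace Ω] {P : Measure Ω} [IsProbabilityMeasure P]

/-- Maximal inequality for finitely many linear functionals of independent centred vectors. -/
theorem integral_norm_weighted_sum_le {n : ℕ} {J V : Type*} [Fintype J] [Fintype V] [Nonempty V]
    {X : Fin n → Ω → J → ℝ} (hm : ∀ i, Measurable (X i)) (hind : iIndepFun X P)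
    (hint : ∀ i j, Integrable (fun ω => X i ω j) P) (h0 : ∀ i j, ∫ ω, X i ω j ∂P = 0)
    {M : Fin n → Ω → ℝ} (hM : ∀ i, Integrable (fun ω => M i ω ^ 2) P) {Q : ℝ} (hQ : 0 < Q)
    (hMQ : ∀ i, ∫ ω, M i ω ^ 2 ∂P ≤ Q) (hn : 1 ≤ n) (D : V → J → ℝ) {B : ℝ} (hB : 0 < B)
    (hD : ∀ i, ∀ᵐ ω ∂P, ∀ v, |∑ j, D v j * X i ω j| ≤ B * M i ω) :
    Integrable (fun ω => ‖∑ i, fun v => ∑ j, D v j * X i ω j‖) P ∧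
    ∫ ω, ‖∑ i, fun v => ∑ j, D v j * X i ω j‖ ∂P ≤
      3 * (B * √(n * Q) * √(logSize V)) := by
  have hn' : (0 : ℝ) < n := by exact_mod_cast hn
  have hφ : Measurable fun (f : J → ℝ) (v : V) => ∑ j, D v j * f j :=
    measurable_pi_lambda _ fun v => Finset.measurable_fun_sum _ fun j _ =>
      (measurable_pi_apply j).const_mul _
  have hI : ∀ i v, Integrable (fun ω => ∑ j, D v j * X i ω j) P := fun i v =>
    integrable_finsetSum _ fun j _ => (hint i j).const_mul _
  have hI' : ∀ i, Integrable (fun ω v => ∑ j, D v j * X i ω j) P := fun i =>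
    Integrable.of_eval (hI i)
  refine ⟨Integrable.norm (f := fun ω => ∑ i, fun v => ∑ j, D v j * X i ω j)
    (integrable_finsetSum _ fun i _ => hI' i), ?_⟩
  refine integral_norm_sum_le (X := fun i ω v => ∑ j, D v j * X i ω j)
    (a := fun i ω => B * M i ω) (fun i => hφ.comp (hm i)) hI'
    (hind.comp (fun _ f v => ∑ j, D v j * f j) fun _ => hφ) (fun i => ?_)
    (fun i => ?_) (fun i => ?_) (by positivity) ?_
  · ext v
    rw [eval_integral (hI i), integral_finsetSum _ fun j _ => (hint i j).const_mul _]
    exact Finset.sum_eq_zero fun j _ => by rw [integral_const_mul, h0, mul_zero]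
  · simp_rw [mul_pow]
    exact (hM i).const_mul _
  · filter_upwards [hD i] with ω hω
    exact (pi_norm_le_iff_of_nonempty _).2 hω
  · simp_rw [mul_pow, integral_const_mul]
    calc ∑ i, B ^ 2 * ∫ ω, M i ω ^ 2 ∂P ≤ ∑ _i : Fin n, B ^ 2 * Q := by
          gcongr with i; exact hMQ i
      _ = B ^ 2 * √(n * Q) ^ 2 := by
        rw [Real.sq_sqrt (by positivity), Finset.sum_const, Finset.card_univ, Fintype.card_fin,
          nsmul_eq_mul]; ring

/-- The constant in the chaining bound for exponent `γ`. -/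
noncomputable def chainConst (d : ℕ) (γ : ℝ) : ℝ :=
  3 * (d + 2) * (1 + ∑' l : ℕ, ((l : ℝ) + 2) * ((2 : ℝ) ^ (-γ)) ^ l) + 1

theorem summable_chain {γ : ℝ} (hγ : 0 < γ) :
    Summable fun l : ℕ => ((l : ℝ) + 2) * ((2 : ℝ) ^ (-γ)) ^ l := by
  have h1 : ‖(2 : ℝ) ^ (-γ)‖ < 1 := by
    rw [Real.norm_of_nonneg (by positivity)]
    exact Real.rpow_lt_one_of_one_lt_of_neg (by norm_num) (by linarith)
  have h2 := summable_pow_mul_geometric_of_norm_lt_one 1 h1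
  have h3 := summable_pow_mul_geometric_of_norm_lt_one 0 h1
  refine (h2.add (h3.mul_left 2)).congr fun l => ?_
  simp; ring

theorem chainConst_pos {γ : ℝ} : 0 < chainConst d γ := by
  have : 0 ≤ ∑' l : ℕ, ((l : ℝ) + 2) * ((2 : ℝ) ^ (-γ)) ^ l := tsum_nonneg fun l => by positivity
  unfold chainConst; positivity

theorem weighted_mean_eq {n : ℕ} {J : Type*} [Fintype J] (W : J → ℝ) (X : Fin n → J → ℝ) :
    ∑ j, W j * ((1 / (n : ℝ)) * ∑ i, X i j) = 1 / (n : ℝ) * ∑ i, ∑ j, W j * X i j := by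
  rw [Finset.sum_comm, Finset.mul_sum]
  refine Finset.sum_congr rfl fun j _ => ?_
  rw [← Finset.mul_sum]; ring

/-- Chaining bound for the supremum of a mean of independent centred random fields that are Hölder
continuous with square integrable constants. -/
theorem exists_chaining_bound {γ : ℝ} (hγ : 0 < γ) {n : ℕ} (hn : 1 ≤ n) {J : Type*} [Fintype J]
    {X : Fin n → Ω → J → ℝ} (hm : ∀ i, Measurable (X i)) (hind : iIndepFun X P)
    (hint : ∀ i j, Integrable (fun ω => X i ω j) P) (h0 : ∀ i j, ∫ ω, X i ω j ∂P = 0)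
    {M : Fin n → Ω → ℝ} (hM : ∀ i, Integrable (fun ω => M i ω ^ 2) P) {Q : ℝ} (hQ : 0 < Q)
    (hMQ : ∀ i, ∫ ω, M i ω ^ 2 ∂P ≤ Q) (W : (Fin d → ℝ) → J → ℝ) {B : ℝ} (hB : 0 < B)
    (hW : ∀ i, ∀ᵐ ω ∂P, (∀ x ∈ unitCube d, |∑ j, W x j * X i ω j| ≤ B * M i ω) ∧
      ∀ x ∈ unitCube d, ∀ y ∈ unitCube d,
        |∑ j, W x j * X i ω j - ∑ j, W y j * X i ω j| ≤ B * M i ω * ‖x - y‖ ^ γ) :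
    ∃ G : Ω → ℝ, Integrable G P ∧ ∫ ω, G ω ∂P ≤ chainConst d γ * B * √Q / √n ∧
      ∀ᵐ ω ∂P, ∀ x ∈ unitCube d, |∑ j, W x j * ((1 / (n : ℝ)) * ∑ i, X i ω j)| ≤ G ω := by
  have hn' : (0 : ℝ) < n := by exact_mod_cast hn
  set ρ : ℝ := (2 : ℝ) ^ (-γ) with hρ
  have hρ0 : 0 < ρ := by positivity
  have hρ1 : ρ < 1 := Real.rpow_lt_one_of_one_lt_of_neg (by norm_num) (by linarith)
  have hρl : ∀ l : ℕ, (1 / ((2 ^ l : ℕ) : ℝ)) ^ γ = ρ ^ l := fun l => by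
    push_cast
    rw [hρ, one_div, ← inv_pow, ← Real.rpow_natCast, ← Real.rpow_mul (by norm_num),
      ← Real.rpow_natCast, ← Real.rpow_mul (by norm_num), Real.inv_rpow (by norm_num),
      ← Real.rpow_neg (by norm_num)]
    congr 1; ring
  -- From level `L` on, increments are below `1/√n` times `B M`, so they are bounded path by path
  -- without using cancellation and finitely many levels suffice. This remainder is the final `+ 1`
  -- in `chainConst`.
  obtain ⟨L, hL⟩ := exists_pow_lt_of_lt_one (show 0 < 1 / √n by positivity) hρ1
  have h2l : ∀ l : ℕ, 1 ≤ 2 ^ l := fun l => Nat.one_le_two_pow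
  set D₀ : (Fin d → Fin (2 ^ 0 + 1)) → J → ℝ := fun v => W (gridPoint (2 ^ 0) v) with hD₀
  set D : ∀ l : ℕ, (Fin d → Fin (2 ^ (l + 1) + 1)) → J → ℝ := fun l v j =>
    W (gridPoint (2 ^ (l + 1)) v) j - W (gridRound (2 ^ l) (gridPoint (2 ^ (l + 1)) v)) j with hD
  -- Nonnegativity of `M` is read off from the uniform bound at the origin.
  have hMn : ∀ i, ∀ᵐ ω ∂P, 0 ≤ M i ω := fun i => by
    filter_upwards [hW i] with ω hω
    have := (abs_nonneg _).trans (hω.1 0 (mem_unitCube.2 fun k => by simp))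
    exact nonneg_of_mul_nonneg_right this hB
  have hlev₀ := integral_norm_weighted_sum_le hm hind hint h0 hM hQ hMQ hn D₀ hB fun i => by
    filter_upwards [hW i] with ω hω v
    exact hω.1 _ (gridPoint_mem (h2l 0) v)
  have hlev : ∀ l, _ := fun l => integral_norm_weighted_sum_le hm hind hint h0 hM hQ hMQ hn (D l)
    (B := B * ρ ^ l) (by positivity) fun i => by
      filter_upwards [hW i, hMn i] with ω hω hMω v
      have h3 := gridPoint_mem (h2l (l + 1)) v
      have h4 := hω.2 _ h3 _ (gridRound_mem (h2l l) h3)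
      simp only [hD, sub_mul, Finset.sum_sub_distrib]
      refine h4.trans ?_
      have h5 : ‖gridPoint (2 ^ (l + 1)) v - gridRound (2 ^ l) (gridPoint (2 ^ (l + 1)) v)‖ ^ γ ≤
          ρ ^ l := by
        rw [← hρl]
        exact Real.rpow_le_rpow (norm_nonneg _) (norm_sub_gridRound_le (h2l l) h3) hγ.le
      calc _ ≤ B * M i ω * ρ ^ l := by gcongr
        _ = _ := by ring
  -- The bound `M ≤ (M² / √Q + √Q) / 2` makes the majorant integrable from `M²` alone, with mean of
  -- order `√Q`.
  set R : Ω → ℝ := fun ω => 1 / (n : ℝ) * ∑ i, B * ((M i ω ^ 2 / √Q + √Q) / 2) * ρ ^ L with hR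
  have hRi : Integrable R P := by
    refine (integrable_finsetSum _ fun i _ => ?_).const_mul _
    exact (((((hM i).div_const _).add (integrable_const _)).div_const _).const_mul _).mul_const _
  have hsQ : 0 < √Q := Real.sqrt_pos.2 hQ
  have hsn : 0 < √(n : ℝ) := Real.sqrt_pos.2 hn'
  have hRint : ∫ ω, R ω ∂P ≤ B * √Q / √n := by
    have h1 : ∀ i, ∫ ω, B * ((M i ω ^ 2 / √Q + √Q) / 2) * ρ ^ L ∂P ≤ B * √Q * ρ ^ L := by
      intro i
      rw [integral_mul_const, integral_const_mul, integral_div,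
        integral_add ((hM i).div_const _) (integrable_const _), integral_div, integral_const,
        probReal_univ, one_smul]
      have h2 : (∫ ω, M i ω ^ 2 ∂P) / √Q ≤ √Q := by
        rw [div_le_iff₀ hsQ, Real.mul_self_sqrt hQ.le]; exact hMQ i
      gcongr
      linarith
    calc ∫ ω, R ω ∂P = 1 / (n : ℝ) * ∑ i, ∫ ω, B * ((M i ω ^ 2 / √Q + √Q) / 2) * ρ ^ L ∂P := by
          rw [hR, integral_const_mul, integral_finsetSum]
          exact fun i _ =>
            (((((hM i).div_const _).add (integrable_const _)).div_const _).const_mul _).mul_const _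
      _ ≤ 1 / (n : ℝ) * ∑ _i : Fin n, B * √Q * (1 / √n) := by
        gcongr with i
        exact (h1 i).trans (by gcongr)
      _ = _ := by
        rw [Finset.sum_const, Finset.card_univ, Fintype.card_fin, nsmul_eq_mul]
        field_simp
  set N₀ : Ω → ℝ := fun ω => ‖∑ i, fun v => ∑ j, D₀ v j * X i ω j‖ with hN₀
  set N : ℕ → Ω → ℝ := fun l ω => ‖∑ i, fun v => ∑ j, D l v j * X i ω j‖ with hN
  have hNsum : Integrable (fun ω => ∑ l ∈ Finset.range L, N l ω) P :=
    integrable_finsetSum _ fun l _ => (hlev l).1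
  have hNN : Integrable (fun ω => 1 / (n : ℝ) * (N₀ ω + ∑ l ∈ Finset.range L, N l ω)) P :=
    (hlev₀.1.add hNsum).const_mul _
  refine ⟨fun ω => 1 / (n : ℝ) * (N₀ ω + ∑ l ∈ Finset.range L, N l ω) + R ω,
    hNN.add hRi, ?_, ?_⟩
  · have h0 : ∫ ω, (1 / (n : ℝ) * (N₀ ω + ∑ l ∈ Finset.range L, N l ω) + R ω) ∂P =
        1 / (n : ℝ) * (∫ ω, N₀ ω ∂P + ∑ l ∈ Finset.range L, ∫ ω, N l ω ∂P) + ∫ ω, R ω ∂P := by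
      rw [integral_add hNN hRi, integral_const_mul, integral_add hlev₀.1 hNsum,
        integral_finsetSum _ fun l _ => (hlev l).1]
    refine h0.trans_le ?_
    have h1 : ∫ ω, N₀ ω ∂P ≤ 3 * (d + 2) * (B * √(n * Q)) := by
      refine hlev₀.2.trans ?_
      have h2 := sqrt_logSize_dyadic_le (d := d) 0
      rw [Nat.cast_zero, zero_add, mul_one] at h2
      calc _ ≤ 3 * (B * √(n * Q) * (d + 2)) := by gcongr
        _ = _ := by ring
    have h2 : ∑ l ∈ Finset.range L, ∫ ω, N l ω ∂P ≤
        3 * (d + 2) * (B * √(n * Q)) * ∑' l : ℕ, ((l : ℝ) + 2) * ρ ^ l := by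
      calc _ ≤ ∑ l ∈ Finset.range L, 3 * (d + 2) * (B * √(n * Q)) * (((l : ℝ) + 2) * ρ ^ l) := by
            refine Finset.sum_le_sum fun l _ => (hlev l).2.trans ?_
            have h3 := sqrt_logSize_dyadic_le (d := d) (l + 1)
            push_cast at h3
            rw [add_assoc, one_add_one_eq_two] at h3
            calc _ ≤ 3 * (B * ρ ^ l * √(n * Q) * ((d + 2) * (l + 2))) := by gcongr
              _ = _ := by ring
        _ ≤ _ := by
          rw [← Finset.mul_sum]
          gcongr
          exact (summable_chain hγ).sum_le_tsum _ fun l _ => by positivity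
    have h3 : 1 / (n : ℝ) * √(n * Q) = √Q / √n := by
      rw [Real.sqrt_mul hn'.le]
      nth_rewrite 1 [← Real.mul_self_sqrt hn'.le]
      field_simp
    calc _ ≤ 1 / (n : ℝ) * (3 * (d + 2) * (B * √(n * Q)) +
          3 * (d + 2) * (B * √(n * Q)) * ∑' l : ℕ, ((l : ℝ) + 2) * ρ ^ l) + B * √Q / √n := by
          gcongr
      _ = (1 / (n : ℝ) * √(n * Q)) * (3 * (d + 2) * B *
          (1 + ∑' l : ℕ, ((l : ℝ) + 2) * ρ ^ l)) + B * √Q / √n := by ring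
      _ = _ := by rw [h3]; unfold chainConst; ring
  · filter_upwards [ae_all_iff.2 hW, ae_all_iff.2 hMn] with ω hω hMω x hx
    set F : (Fin d → ℝ) → ℝ := fun y => 1 / (n : ℝ) * ∑ i, ∑ j, W y j * X i ω j with hF
    have hx' : ∀ l, gridRound (2 ^ l) x ∈ unitCube d := fun l => gridRound_mem (h2l l) hx
    rw [weighted_mean_eq]
    have h1 : F x = F (gridRound (2 ^ 0) x) + ∑ l ∈ Finset.range L,
        (F (gridRound (2 ^ (l + 1)) x) - F (gridRound (2 ^ l) x)) +
        (F x - F (gridRound (2 ^ L) x)) := by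
      rw [Finset.sum_range_sub fun l => F (gridRound (2 ^ l) x)]; ring
    have h2 : |F (gridRound (2 ^ 0) x)| ≤ 1 / (n : ℝ) * N₀ ω := by
      obtain ⟨v, hv⟩ := exists_gridPoint_eq (N := 2 ^ 0) hx
      have h3 := norm_le_pi_norm (∑ i, fun v => ∑ j, D₀ v j * X i ω j) v
      rw [Finset.sum_apply, Real.norm_eq_abs] at h3
      rw [hF, abs_mul, abs_of_pos (by positivity), ← hv]
      gcongr
    have h3 : ∀ l, |F (gridRound (2 ^ (l + 1)) x) - F (gridRound (2 ^ l) x)| ≤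
        1 / (n : ℝ) * N l ω := fun l => by
      obtain ⟨v, hv⟩ := exists_gridPoint_eq (N := 2 ^ (l + 1)) hx
      have h3 := norm_le_pi_norm (∑ i, fun v => ∑ j, D l v j * X i ω j) v
      rw [Finset.sum_apply, Real.norm_eq_abs] at h3
      simp only [hF]
      rw [← mul_sub, abs_mul, abs_of_pos (by positivity), ← gridRound_gridRound l x, ← hv,
        ← Finset.sum_sub_distrib]
      gcongr
      refine le_trans (le_of_eq ?_) h3
      congr 1
      refine Finset.sum_congr rfl fun i _ => ?_
      rw [← Finset.sum_sub_distrib]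
      exact Finset.sum_congr rfl fun j _ => by simp only [hD]; ring
    have h4 : |F x - F (gridRound (2 ^ L) x)| ≤ R ω := by
      simp only [hF, hR]
      rw [← mul_sub, abs_mul, abs_of_pos (by positivity), ← Finset.sum_sub_distrib]
      gcongr
      refine (Finset.abs_sum_le_sum_abs _ _).trans (Finset.sum_le_sum fun i _ => ?_)
      refine ((hω i).2 x hx _ (hx' L)).trans ?_
      have h5 : ‖x - gridRound (2 ^ L) x‖ ^ γ ≤ ρ ^ L := by
        rw [← hρl]
        exact Real.rpow_le_rpow (norm_nonneg _) (norm_sub_gridRound_le (h2l L) hx) hγ.le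
      have h6 : M i ω ≤ (M i ω ^ 2 / √Q + √Q) / 2 := by
        have h7 : 0 ≤ (M i ω - √Q) ^ 2 / √Q := by positivity
        have h8 : (M i ω - √Q) ^ 2 / √Q = M i ω ^ 2 / √Q + √Q - 2 * M i ω := by
          field_simp; ring
        linarith
      have := hMω i
      gcongr
    change |F x| ≤ _
    rw [h1]
    refine (abs_add_le _ _).trans (add_le_add ((abs_add_le _ _).trans ?_) h4)
    rw [mul_add, Finset.mul_sum]
    exact add_le_add h2 ((Finset.abs_sum_le_sum_abs _ _).trans (Finset.sum_le_sum fun l _ => h3 l))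

end Chaining

/-! ### Process and error contributions to the risk. -/

section Model

theorem linearEstimator_observation {d : ℕ} {Ω : Type*} {n : ℕ} {p : Fin d → ℕ}
    {Z : Fin n → (Fin d → ℝ) → Ω → ℝ} {ε : Fin n → Grid p → Ω → ℝ}
    {t : ∀ k : Fin d, Fin (p k) → ℝ} {w : ℝ → (Fin d → ℝ) → Grid p → ℝ} (hn : 1 ≤ n)
    (μ : (Fin d → ℝ) → ℝ) (h : ℝ) (x : Fin d → ℝ)
    (ω : Ω) :
    linearEstimator w h (fun i j => observation t μ Z ε i j ω) x =
      weightSum t w h x μ + ∑ j, w h x j * ((1 / (n : ℝ)) * ∑ i, Z i (designPoint t j) ω) +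
        ∑ j, w h x j * ((1 / (n : ℝ)) * ∑ i, ε i j ω) := by
  have hn' : (n : ℝ) ≠ 0 := by exact_mod_cast (by omega : n ≠ 0)
  unfold linearEstimator weightSum observation
  rw [← Finset.sum_add_distrib, ← Finset.sum_add_distrib]
  refine Finset.sum_congr rfl fun j _ => ?_
  rw [Finset.sum_add_distrib, Finset.sum_add_distrib, Finset.sum_const, Finset.card_univ,
    Fintype.card_fin, nsmul_eq_mul]
  field_simp

variable {d : ℕ} {Ω : Type*} [MeasurableSpace Ω] {P : Measure Ω}
  {β CZ σ ζ : ℝ} {n : ℕ} {p : Fin d → ℕ} {Z : Fin n → (Fin d → ℝ) → Ω → ℝ}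
  {ε : Fin n → Grid p → Ω → ℝ} {t : ∀ k : Fin d, Fin (p k) → ℝ} {Cd : ℝ}

/-- The contribution of the mean of the processes to the sup-norm risk. -/
theorem FunctionalDataModel.exists_process_bound [IsProbabilityMeasure P]
    (hmod : FunctionalDataModel P β CZ σ ζ n p Z ε) (hn : 1 ≤ n) (hCZ : 0 < CZ)
    (ht : RegularDesign Cd p t) {B η : ℝ} (hB : 0 < B) (hη : 0 < η)
    (W : (Fin d → ℝ) → Grid p → ℝ)
    (hW : ∀ (f : (Fin d → ℝ) → ℝ) (M : ℝ), HolderClass β M f →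
      (∀ x ∈ unitCube d, |∑ j, W x j * f (designPoint t j)| ≤ B * max M 0) ∧
      ∀ x ∈ unitCube d, ∀ y ∈ unitCube d,
        |∑ j, W x j * f (designPoint t j) - ∑ j, W y j * f (designPoint t j)| ≤
          B * max M 0 * ‖x - y‖ ^ η) :
    ∃ G : Ω → ℝ, Integrable G P ∧ ∫ ω, G ω ∂P ≤ chainConst d η * B * √CZ / √n ∧
      ∀ᵐ ω ∂P, ∀ x ∈ unitCube d,
        |∑ j, W x j * ((1 / (n : ℝ)) * ∑ i, Z i (designPoint t j) ω)| ≤ G ω := by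
  choose M hM hMC hMZ using fun i => (hmod.process_class i).2
  have hmem := ht.designPoint_mem
  have hφ : Measurable fun (f : unitCube d → ℝ) (j : Grid p) => f ⟨designPoint t j, hmem j⟩ :=
    measurable_pi_lambda _ fun j => measurable_pi_apply _
  have hZm : ∀ i j, Measurable (Z i (designPoint t j)) := fun i j =>
    (hmod.process_class i).1 _ (hmem j)
  refine exists_chaining_bound (X := fun i ω j => Z i (designPoint t j) ω)
    (M := fun i ω => |M i ω|) hη hn (fun i => measurable_pi_lambda _ fun j => hZm i j)
    (hmod.process_indep.comp (fun _ f j => f ⟨designPoint t j, hmem j⟩) fun _ => hφ)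
    (fun i j => ?_) (fun i j => hmod.process_centred i _ (hmem j)) (fun i => ?_) hCZ
    (fun i => ?_) W hB fun i => ?_
  · refine Integrable.mono' ((hM i).integrable (by norm_num)).norm
      (hZm i j).aestronglyMeasurable ?_
    filter_upwards [hMZ i] with ω hω
    -- The Hölder norm includes the derivative of order zero, so `M` also dominates the values of
    -- the path.
    have h1 := hω.abs_multiPartial_le (k := 0) (by simp) (hmem j)
    rw [multiPartial_zero] at h1
    exact h1.trans (max_le (le_abs_self _) (abs_nonneg _))
  · simp_rw [sq_abs]
    exact (hM i).integrable_sq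
  · simp_rw [sq_abs]
    exact hMC i
  · filter_upwards [hMZ i] with ω hω
    have h1 : max (M i ω) 0 ≤ |M i ω| := max_le (le_abs_self _) (abs_nonneg _)
    obtain ⟨h2, h3⟩ := hW _ _ hω
    exact ⟨fun x hx => (h2 x hx).trans (by gcongr),
      fun x hx y hy => (h3 x hx y hy).trans (by gcongr)⟩

variable {s : Fin d → ℕ} {m : ℕ} {c h₀ C₁ C₂ : ℝ} {w : ℝ → (Fin d → ℝ) → Grid p → ℝ}

/-- The size of the squared weights. -/
theorem WeightCondition.sum_sq_le (hw : WeightCondition s m c h₀ C₁ C₂ p t w)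
    (ht : RegularDesign Cd p t) (hp : 1 ≤ pMin p) (hc : 0 < c) {h : ℝ}
    (hh : h ∈ Set.Ioc (c / (pMin p : ℝ)) h₀) {x : Fin d → ℝ} (hx : x ∈ unitCube d) :
    ∑ j, w h x j ^ 2 ≤ windowConst d Cd c * C₁ ^ 2 / (pProd p * h ^ (d + 2 * ∑ k, s k)) := by
  have hh0 : 0 < h := lt_of_le_of_lt (by positivity) hh.1
  have hpp : (0 : ℝ) < pProd p := by exact_mod_cast pProd_pos hp
  refine (le_abs_self _).trans ((ht.abs_sum_le hc hp hh.1 hx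
    (B := (C₁ / ((pProd p : ℝ) * h ^ (d + ∑ k, s k))) ^ 2) (by positivity) (fun j _ => ?_)
      (fun j hj => ?_)).trans (le_of_eq ?_))
  · rw [abs_pow]
    exact pow_le_pow_left₀ (abs_nonneg _) (hw.bounded h hh x hx j) 2
  · rw [hw.localize h hh x hx j hj]; ring
  · rw [two_mul, ← add_assoc, pow_add, pow_add, pow_add]; field_simp

/-- The proxies of independent summands add: `n` terms per design point, each with coefficient `W j
/ n`, leave a factor `1 / n`. -/
theorem FunctionalDataModel.weighted_error_subgaussian
    (hmod : FunctionalDataModel P β CZ σ ζ n p Z ε) (hn : 1 ≤ n) (W : Grid p → ℝ) {A : ℝ}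
    (hA : ∑ j, W j ^ 2 ≤ A) :
    ∃ κ : NNReal, (κ : ℝ) ≤ ζ ^ 2 * σ ^ 2 * A / n ∧
      HasSubgaussianMGF (fun ω => ∑ j, W j * ((1 / (n : ℝ)) * ∑ i, ε i j ω)) κ P := by
  have hn' : (0 : ℝ) < n := by exact_mod_cast hn
  have hind : iIndepFun (fun (ij : Fin n × Grid p) ω => W ij.2 / n * ε ij.1 ij.2 ω) P :=
    hmod.error_indep.comp (fun ij u => W ij.2 / n * u) fun ij => measurable_id.const_mul _
  have h1 := HasSubgaussianMGF.sum_of_iIndepFun hind (s := Finset.univ)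
    fun ij _ => (hmod.error_subGaussian ij.1 ij.2).const_mul (W ij.2 / n)
  refine ⟨_, ?_, h1.congr (ae_of_all _ fun ω => ?_)⟩
  · have h2 : ∀ ij : Fin n × Grid p, (W ij.2 / n) ^ 2 *
        max (ζ ^ 2 * ∫ ω, ε ij.1 ij.2 ω ^ 2 ∂P) 0 ≤ (W ij.2 / n) ^ 2 * (ζ ^ 2 * σ ^ 2) :=
      fun ij => by
        gcongr
        refine max_le ?_ (by positivity)
        gcongr
        exact hmod.error_variance ij.1 ij.2
    push_cast
    refine (Finset.sum_le_sum fun ij _ => h2 ij).trans ?_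
    rw [Fintype.sum_prod_type]
    simp only
    rw [Finset.sum_const, Finset.card_univ, Fintype.card_fin, nsmul_eq_mul, ← Finset.sum_mul]
    simp_rw [div_pow]
    rw [← Finset.sum_div]
    calc (n : ℝ) * ((∑ j, W j ^ 2) / n ^ 2 * (ζ ^ 2 * σ ^ 2))
        ≤ n * (A / n ^ 2 * (ζ ^ 2 * σ ^ 2)) := by gcongr
      _ = _ := by field_simp
  · beta_reduce
    rw [weighted_mean_eq, Fintype.sum_prod_type, Finset.mul_sum]
    refine Finset.sum_congr rfl fun i _ => ?_
    rw [Finset.mul_sum]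
    exact Finset.sum_congr rfl fun j _ => by ring

theorem log_two_ge_half : (1 : ℝ) / 2 ≤ Real.log 2 := by linarith [Real.log_two_gt_d9]

/-- Refining the grid to any fixed power of `m` changes the logarithm only by a constant, so
discretization is essentially free. -/
theorem logSize_grid_pow_le {m : ℕ} (hm : 2 ≤ m) (e : ℕ) :
    logSize (Fin d → Fin (m ^ e + 1)) ≤ (d * (1 + e) + 4) * Real.log m := by
  have hm' : (2 : ℝ) ≤ m := by exact_mod_cast hm
  have h1 : Real.log 2 ≤ Real.log m := Real.log_le_log (by norm_num) hm'
  have h2 : Real.log (((m ^ e : ℕ) : ℝ) + 1) ≤ (1 + e) * Real.log m := by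
    have h3 : (1 : ℝ) ≤ (m : ℝ) ^ e := one_le_pow₀ (by linarith)
    calc Real.log (((m ^ e : ℕ) : ℝ) + 1) ≤ Real.log (m * (m : ℝ) ^ e) := by
          refine Real.log_le_log (by positivity) ?_
          push_cast
          nlinarith
      _ = _ := by
        rw [Real.log_mul (by positivity) (by positivity), Real.log_pow]; ring
  rw [logSize_grid]
  have h4 : (d : ℝ) * Real.log (((m ^ e : ℕ) : ℝ) + 1) ≤ d * ((1 + e) * Real.log m) := by gcongr
  have := log_two_ge_half
  linarith

/-- The contribution of the errors to the sup-norm risk, for a general grid of mesh `1 / N`. -/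
theorem FunctionalDataModel.exists_error_bound_grid [IsProbabilityMeasure P]
    (hmod : FunctionalDataModel P β CZ σ ζ n p Z ε) (hn : 1 ≤ n)
    (hw : WeightCondition s m c h₀ C₁ C₂ p t w)
    (ht : RegularDesign Cd p t) (hp : 1 ≤ pMin p) (hc : 0 < c) (hCd : 0 < Cd) (hC₂ : 0 < C₂)
    {h : ℝ} (hh : h ∈ Set.Ioc (c / (pMin p : ℝ)) h₀) {N : ℕ} (hN : 1 ≤ N) :
    ∃ G : Ω → ℝ, Integrable G P ∧
      ∫ ω, G ω ∂P ≤ 3 / 2 * (√((ζ ^ 2 * σ ^ 2 * (windowConst d Cd c * C₁ ^ 2) + 1) /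
          (n * pProd p * h ^ (d + 2 * ∑ k, s k))) * √(logSize (Fin d → Fin (N + 1)))) +
        C₂ * (1 + σ ^ 2) / (h ^ (d + ∑ k, s k + 1) * N) ∧
      ∀ ω, ∀ x ∈ unitCube d,
        |∑ j, w h x j * ((1 / (n : ℝ)) * ∑ i, ε i j ω)| ≤ G ω := by
  have hn' : (0 : ℝ) < n := by exact_mod_cast hn
  have hN' : (0 : ℝ) < N := by exact_mod_cast hN
  have hh0 : 0 < h := lt_of_le_of_lt (by positivity) hh.1
  have hpp : (0 : ℝ) < pProd p := by exact_mod_cast pProd_pos hp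
  have hwc := windowConst_pos (d := d) (c := c) hCd
  set S := ∑ k, s k with hS
  -- The summand `1` keeps `τ` positive when the error variance bound is zero.
  set τ := √((ζ ^ 2 * σ ^ 2 * (windowConst d Cd c * C₁ ^ 2) + 1) /
          (n * pProd p * h ^ (d + 2 * S))) with hτ
  have hτ0 : 0 < τ := Real.sqrt_pos.2 (by positivity)
  choose κ hκ hκG using fun v : Fin d → Fin (N + 1) =>
    hmod.weighted_error_subgaussian hn (w h (gridPoint N v))
      (hw.sum_sq_le ht hp hc hh (gridPoint_mem hN v))
  have hκτ : ∀ v, (κ v : ℝ) ≤ τ ^ 2 := fun v => by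
    refine (hκ v).trans ?_
    rw [hτ, Real.sq_sqrt (by positivity)]
    have h1 : ζ ^ 2 * σ ^ 2 * (windowConst d Cd c * C₁ ^ 2 / (pProd p * h ^ (d + 2 * S))) / n =
        ζ ^ 2 * σ ^ 2 * (windowConst d Cd c * C₁ ^ 2) / (n * pProd p * h ^ (d + 2 * S)) := by
      field_simp
    rw [h1]
    gcongr
    linarith
  obtain ⟨hYi, hYb⟩ := integral_norm_le_of_subgaussian hκG hτ0 hκτ
  have hεi : ∀ i j, Integrable (fun ω => ε i j ω ^ 2) P := fun i j =>
    ((hmod.error_subGaussian i j).memLp 2).integrable_sq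
  set b := C₂ / (pProd p * h ^ (d + S)) * (1 / N / h) with hb
  have hb0 : 0 < b := by positivity
  have hεi1 : ∀ i j, Integrable (fun ω => 1 + ε i j ω ^ 2) P := fun i j =>
    (integrable_const _).add (hεi i j)
  have hεi' : ∀ j, Integrable (fun ω => ∑ i, (1 + ε i j ω ^ 2)) P := fun j =>
    integrable_finsetSum _ fun i _ => hεi1 i j
  -- Off the grid the weight increments are summed over all design points, with `|ε| ≤ 1 + ε²` and
  -- no cancellation. Giving up localization and averaging is harmless because `N` is free.
  set R : Ω → ℝ := fun ω => ∑ j, b * ((1 / (n : ℝ)) * ∑ i, (1 + ε i j ω ^ 2)) with hR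
  have hRi : Integrable R P :=
    integrable_finsetSum _ fun j _ => ((hεi' j).const_mul _).const_mul _
  refine ⟨fun ω => ‖fun v => ∑ j, w h (gridPoint N v) j * ((1 / (n : ℝ)) * ∑ i, ε i j ω)‖ + R ω,
    hYi.add hRi, ?_, fun ω x hx => ?_⟩
  · rw [integral_add hYi hRi]
    refine add_le_add hYb ?_
    calc ∫ ω, R ω ∂P = ∑ j, b * ((1 / (n : ℝ)) * ∑ i, (1 + ∫ ω, ε i j ω ^ 2 ∂P)) := by
          rw [hR, integral_finsetSum _ fun j _ => ((hεi' j).const_mul _).const_mul _]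
          refine Finset.sum_congr rfl fun j _ => ?_
          rw [integral_const_mul, integral_const_mul,
            integral_finsetSum _ fun i _ => hεi1 i j]
          congr 2
          refine Finset.sum_congr rfl fun i _ => ?_
          rw [integral_add (integrable_const _) (hεi i j), integral_const, probReal_univ, one_smul]
      _ ≤ ∑ _j : Grid p, b * ((1 / (n : ℝ)) * ∑ _i : Fin n, (1 + σ ^ 2)) := by
        gcongr with j _ i _
        exact hmod.error_variance i j
      _ = _ := by
        rw [Finset.sum_const, Finset.sum_const, Finset.card_univ, Finset.card_univ,
          Fintype.card_fin, nsmul_eq_mul, nsmul_eq_mul, Fintype.card_pi]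
        simp only [Fintype.card_fin]
        rw [show ((∏ k, p k : ℕ) : ℝ) = pProd p from rfl, hb, pow_succ h (d + S)]
        field_simp
  · obtain ⟨v, hv⟩ := exists_gridPoint_eq (N := N) hx
    have h1 := norm_le_pi_norm
      (fun v => ∑ j, w h (gridPoint N v) j * ((1 / (n : ℝ)) * ∑ i, ε i j ω)) v
    rw [Real.norm_eq_abs] at h1
    have h2 : |∑ j, w h x j * ((1 / (n : ℝ)) * ∑ i, ε i j ω) -
        ∑ j, w h (gridPoint N v) j * ((1 / (n : ℝ)) * ∑ i, ε i j ω)| ≤ R ω := by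
      rw [← Finset.sum_sub_distrib]
      refine (Finset.abs_sum_le_sum_abs _ _).trans (Finset.sum_le_sum fun j _ => ?_)
      rw [← sub_mul, abs_mul]
      have h3 : |w h x j - w h (gridPoint N v) j| ≤ b := by
        refine (hw.lipschitz h hh x hx _ (gridPoint_mem hN v) j).trans ?_
        rw [hb]
        gcongr
        refine (min_le_left _ _).trans ?_
        rw [hv]
        gcongr
        exact norm_sub_gridRound_le hN hx
      have h4 : |(1 / (n : ℝ)) * ∑ i, ε i j ω| ≤ (1 / (n : ℝ)) * ∑ i, (1 + ε i j ω ^ 2) := by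
        rw [abs_mul, abs_of_pos (by positivity)]
        gcongr
        refine (Finset.abs_sum_le_sum_abs _ _).trans (Finset.sum_le_sum fun i _ => ?_)
        nlinarith [sq_abs (ε i j ω), sq_nonneg (|ε i j ω| - 1), abs_nonneg (ε i j ω)]
      exact mul_le_mul h3 h4 (abs_nonneg _) hb0.le
    have h5 := abs_add_le (∑ j, w h (gridPoint N v) j * ((1 / (n : ℝ)) * ∑ i, ε i j ω))
      (∑ j, w h x j * ((1 / (n : ℝ)) * ∑ i, ε i j ω) -
        ∑ j, w h (gridPoint N v) j * ((1 / (n : ℝ)) * ∑ i, ε i j ω))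
    rw [add_sub_cancel] at h5
    linarith

theorem noiseLevel_nonneg (hn : 1 ≤ n) (hp : 1 ≤ pMin p) : 0 ≤ noiseLevel n p := by
  have h1 : (1 : ℝ) ≤ (n : ℝ) * pProd p := by
    exact_mod_cast Nat.one_le_iff_ne_zero.2 (Nat.mul_ne_zero (by omega) (pProd_pos hp).ne')
  exact div_nonneg (Real.log_nonneg h1) (by linarith)

/-- The constant in the bound for the errors. -/
noncomputable def errorConst (d : ℕ) (α Cd σ ζ c h₀ C₁ C₂ a : ℝ) : ℝ :=
  3 / 2 * √((ζ ^ 2 * σ ^ 2 * (windowConst d Cd c * C₁ ^ 2) + 1) *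
    (d * (1 + (⌈α + d + 1⌉₊ : ℝ)) + 4) / a ^ (2 * α + d)) +
  C₂ * (1 + σ ^ 2) * (h₀ ^ ((⌈α + d + 1⌉₊ : ℝ) - (α + d + 1)) / c ^ ⌈α + d + 1⌉₊)

/-- The contribution of the errors to the sup-norm risk at bandwidths above the noise level. -/
theorem FunctionalDataModel.exists_error_bound [IsProbabilityMeasure P]
    (hmod : FunctionalDataModel P β CZ σ ζ n p Z ε) (hn : 2 ≤ n)
    (hw : WeightCondition s m c h₀ C₁ C₂ p t w) (hd : 1 ≤ d)
    (ht : RegularDesign Cd p t) (hp : 1 ≤ pMin p) (hc : 0 < c) (hCd : 0 < Cd) (hC₂ : 0 < C₂)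
    {h : ℝ} (hh : h ∈ Set.Ioc (c / (pMin p : ℝ)) h₀) {α a : ℝ} (hα : 0 < α) (ha : 0 < a)
    (hah : a * noiseLevel n p ^ (1 / (2 * α + d)) ≤ h) :
    ∃ G : Ω → ℝ, Integrable G P ∧
      ∫ ω, G ω ∂P ≤ errorConst d α Cd σ ζ c h₀ C₁ C₂ a * h ^ (α - ((∑ k, s k : ℕ) : ℝ)) ∧
      ∀ ω, ∀ x ∈ unitCube d,
        |∑ j, w h x j * ((1 / (n : ℝ)) * ∑ i, ε i j ω)| ≤ G ω := by
  have hn' : (0 : ℝ) < n := by exact_mod_cast (by omega : 0 < n)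
  have hh0 : 0 < h := lt_of_le_of_lt (by positivity) hh.1
  have hpp : (0 : ℝ) < pProd p := by exact_mod_cast pProd_pos hp
  have hh₀ : 0 < h₀ := hh0.trans_le hh.2
  have hpm : (0 : ℝ) < pMin p := by exact_mod_cast hp
  have hwc := windowConst_pos (d := d) (c := c) hCd
  set S := ∑ k, s k with hS
  -- Since `1 / (n p^1)` is at most `h / c`, a grid with `N = (n p^1) ^ e` has discretization error
  -- of order `h ^ (e - d - S - 1)`, which this `e` brings down to `h ^ (α - S)`.
  set e := ⌈α + d + 1⌉₊ with he
  have heα : α + d + 1 ≤ e := Nat.le_ceil _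
  have hm2 : 2 ≤ n * pProd p := by
    have := pProd_pos hp
    nlinarith
  have hN : 1 ≤ (n * pProd p) ^ e := Nat.one_le_pow _ _ (by omega)
  obtain ⟨G, hG, hGb, hGx⟩ :=
    hmod.exists_error_bound_grid (by omega) hw ht hp hc hCd hC₂ hh hN
  refine ⟨G, hG, hGb.trans ?_, hGx⟩
  have hr0 := noiseLevel_nonneg (p := p) (by omega : 1 ≤ n) hp
  have hαd : 0 < 2 * α + d := by positivity
  -- This is the balance of squared bias and variance: a noise level of at most order `h ^ (2α + d)`
  -- makes the noise comparable to `h ^ (α - S)`.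
  have hpow : (h ^ (α - (S : ℝ))) ^ 2 = h ^ (2 * α + d) / h ^ (d + 2 * S) := by
    rw [← Real.rpow_natCast, ← Real.rpow_mul hh0.le, ← Real.rpow_natCast, ← Real.rpow_sub hh0]
    congr 1; push_cast; ring
  have hr : noiseLevel n p ≤ h ^ (2 * α + d) / a ^ (2 * α + d) := by
    have h1 : noiseLevel n p ^ (1 / (2 * α + d)) ≤ h / a := by
      rw [le_div_iff₀ ha]; linarith
    have h2 := Real.rpow_le_rpow (by positivity) h1 hαd.le
    rwa [← Real.rpow_mul hr0, one_div_mul_cancel hαd.ne', Real.rpow_one,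
      Real.div_rpow hh0.le ha.le] at h2
  unfold errorConst
  rw [← he, add_mul]
  refine add_le_add ?_ ?_
  · rw [mul_assoc (3 / 2 : ℝ), ← Real.sqrt_mul (by positivity)]
    gcongr
    rw [← Real.sqrt_sq (show 0 ≤ h ^ (α - (S : ℝ)) by positivity),
      ← Real.sqrt_mul (by positivity)]
    refine Real.sqrt_le_sqrt ?_
    set A := ζ ^ 2 * σ ^ 2 * (windowConst d Cd c * C₁ ^ 2) + 1 with hA
    have hA0 : 0 < A := by positivity
    calc A / (n * pProd p * h ^ (d + 2 * S)) * logSize (Fin d → Fin ((n * pProd p) ^ e + 1))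
        ≤ A / (n * pProd p * h ^ (d + 2 * S)) *
          ((d * (1 + e) + 4) * Real.log ((n * pProd p : ℕ) : ℝ)) := by
          gcongr
          exact logSize_grid_pow_le hm2 e
      _ = A * (d * (1 + e) + 4) * noiseLevel n p / h ^ (d + 2 * S) := by
        unfold noiseLevel
        push_cast
        field_simp
      _ ≤ A * (d * (1 + e) + 4) * (h ^ (2 * α + d) / a ^ (2 * α + d)) / h ^ (d + 2 * S) := by
        gcongr
      _ = _ := by rw [hpow]; ring
  · have h1 : 1 / ((n : ℝ) * pProd p) ≤ h / c := by
      have h2 : (pMin p : ℝ) ≤ n * pProd p := by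
        have h3 := pMin_le_pProd hd hp
        exact_mod_cast h3.trans (Nat.le_mul_of_pos_left _ (by omega))
      rw [le_div_iff₀ hc]
      calc 1 / ((n : ℝ) * pProd p) * c ≤ 1 / (pMin p : ℝ) * c := by gcongr
        _ = c / pMin p := by ring
        _ ≤ h := hh.1.le
    have h2 : 1 / (((n * pProd p) ^ e : ℕ) : ℝ) ≤ h ^ e / c ^ e := by
      push_cast
      rw [← one_div_pow, ← div_pow]
      exact pow_le_pow_left₀ (by positivity) h1 e
    have h3 : h ^ e ≤ h₀ ^ ((e : ℝ) - (α + d + 1)) * h ^ (α + d + 1) := by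
      rw [← Real.rpow_natCast]
      calc h ^ (e : ℝ) = h ^ ((e : ℝ) - (α + d + 1)) * h ^ (α + d + 1) := by
            rw [← Real.rpow_add hh0]; congr 1; ring
        _ ≤ _ := mul_le_mul_of_nonneg_right (Real.rpow_le_rpow hh0.le hh.2 (by linarith))
          (by positivity)
    have h4 : h ^ (α + d + 1) = h ^ (α - (S : ℝ)) * h ^ (d + S + 1) := by
      rw [← Real.rpow_natCast h (d + S + 1), ← Real.rpow_add hh0]
      congr 1; push_cast; ring
    calc C₂ * (1 + σ ^ 2) / (h ^ (d + S + 1) * (((n * pProd p) ^ e : ℕ) : ℝ))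
        = C₂ * (1 + σ ^ 2) / h ^ (d + S + 1) * (1 / (((n * pProd p) ^ e : ℕ) : ℝ)) := by
          field_simp
      _ ≤ C₂ * (1 + σ ^ 2) / h ^ (d + S + 1) *
          (h₀ ^ ((e : ℝ) - (α + d + 1)) * h ^ (α + d + 1) / c ^ e) :=
        mul_le_mul_of_nonneg_left (h2.trans (div_le_div_of_nonneg_right h3 (by positivity)))
          (by positivity)
      _ = _ := by rw [h4]; field_simp

/-- The sup-norm risk is bounded by the sum of the bounds for the bias, the processes and the
errors. -/
theorem supRisk_le [IsProbabilityMeasure P] (hn : 1 ≤ n) {μ : (Fin d → ℝ) → ℝ} {h b₁ b₂ b₃ : ℝ}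
    (hμ : ∀ x ∈ unitCube d, |weightSum t w h x μ - multiPartial s μ x| ≤ b₁)
    (hZ : ∃ G : Ω → ℝ, Integrable G P ∧ ∫ ω, G ω ∂P ≤ b₂ ∧ ∀ᵐ ω ∂P, ∀ x ∈ unitCube d,
      |∑ j, w h x j * ((1 / (n : ℝ)) * ∑ i, Z i (designPoint t j) ω)| ≤ G ω)
    (hε : ∃ G : Ω → ℝ, Integrable G P ∧ ∫ ω, G ω ∂P ≤ b₃ ∧ ∀ ω, ∀ x ∈ unitCube d,
      |∑ j, w h x j * ((1 / (n : ℝ)) * ∑ i, ε i j ω)| ≤ G ω) :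
    supRisk P s t w h μ Z ε ≤ ENNReal.ofReal (b₁ + b₂ + b₃) := by
  obtain ⟨G, hG, hGb, hGx⟩ := hZ
  obtain ⟨G', hG', hGb', hGx'⟩ := hε
  have hi₁ : Integrable (fun ω => b₁ + G ω) P := (integrable_const _).add hG
  have hi : Integrable (fun ω => b₁ + G ω + G' ω) P := hi₁.add hG'
  have hle : ∀ᵐ ω ∂P, ∀ x ∈ unitCube d,
      |linearEstimator w h (fun i j => observation t μ Z ε i j ω) x - multiPartial s μ x| ≤
        b₁ + G ω + G' ω := by
    filter_upwards [hGx] with ω hω x hx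
    have h1 := hμ x hx
    have h2 := hω x hx
    have h3 := hGx' ω x hx
    rw [linearEstimator_observation hn, add_sub_right_comm, add_sub_right_comm]
    exact (abs_add_le _ _).trans (add_le_add ((abs_add_le _ _).trans (add_le_add h1 h2)) h3)
  have h0 : (0 : Fin d → ℝ) ∈ unitCube d := mem_unitCube.2 fun k => by simp
  -- The supremum over `x` is not shown to be measurable; monotonicity of the lower integral against
  -- an integrable majorant is enough.
  calc supRisk P s t w h μ Z ε ≤ ∫⁻ ω, ENNReal.ofReal (b₁ + G ω + G' ω) ∂P := by
        refine lintegral_mono_ae ?_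
        filter_upwards [hle] with ω hω
        exact iSup₂_le fun x hx => ENNReal.ofReal_le_ofReal (hω x hx)
    _ = ENNReal.ofReal (∫ ω, (b₁ + G ω + G' ω) ∂P) := by
      refine (ofReal_integral_eq_lintegral_ofReal hi ?_).symm
      filter_upwards [hle] with ω hω
      exact (abs_nonneg _).trans (hω 0 h0)
    _ ≤ _ := by
      refine ENNReal.ofReal_le_ofReal ?_
      rw [integral_add hi₁ hG', integral_add (integrable_const _) hG,
        integral_const, probReal_univ, one_smul]
      linarith

end Model

/-! ### Bounds with constants independent of the sample and the bandwidth. -/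

section Rates

theorem max_rpow_of_nonneg {u v θ : ℝ} (hu : 0 ≤ u) (hv : 0 ≤ v) (hθ : 0 ≤ θ) :
    max u v ^ θ = max (u ^ θ) (v ^ θ) := by
  rcases le_total u v with h | h
  · rw [max_eq_right h, max_eq_right (Real.rpow_le_rpow hu h hθ)]
  · rw [max_eq_left h, max_eq_left (Real.rpow_le_rpow hv h hθ)]

theorem le_strictFloor_add_one (β : ℝ) : β ≤ (strictFloor β : ℝ) + 1 := by
  refine (Nat.le_ceil β).trans ?_
  have h1 : ⌈β⌉₊ ≤ strictFloor β + 1 := by unfold strictFloor; omega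
  exact_mod_cast h1

variable {d : ℕ}

theorem HolderTop.mono {q : ℕ} {γ A A' : ℝ} {f : (Fin d → ℝ) → ℝ} (hf : HolderTop q γ A f)
    (hA : A ≤ A') : HolderTop q γ A' f where
  contDiffOn := hf.contDiffOn
  holder k hk x hx y hy := (hf.holder k hk x hx y hy).trans (by gcongr)

/-- Functions of smoothness above `q` have Hölder continuous derivatives of order `q`. -/
theorem exists_holderTop_of_lt (hd : 1 ≤ d) {β : ℝ} (hβ : 0 < β) {q : ℕ} (hq : (q : ℝ) < β) :
    ∃ γ : ℝ, 0 < γ ∧ γ ≤ 1 ∧ ∀ (f : (Fin d → ℝ) → ℝ) (M : ℝ), HolderClass β M f →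
      HolderTop q γ (d * max M 0) f := by
  -- At the top order the exponent is `β - q`, which lies in `(0, 1]`; below it the derivatives are
  -- Lipschitz. The factor `d` is only needed in the second case.
  rcases ((strictFloor_isGreatest hβ).2 hq).eq_or_lt with h | h
  · refine ⟨β - q, by linarith, ?_, fun f M hf => ?_⟩
    · have := le_strictFloor_add_one β
      rw [← h] at this
      linarith
    · have h1 := hf.holderTop hβ
      rw [← h] at h1
      refine h1.mono (le_mul_of_one_le_left (le_max_right _ _) ?_)
      exact_mod_cast hd
  · exact ⟨1, one_pos, le_rfl, fun f M hf => hf.holderTop_of_lt h⟩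

variable {s : Fin d → ℕ} {m : ℕ} {c h₀ C₁ C₂ Cd : ℝ} {p : Fin d → ℕ}
  {t : ∀ k : Fin d, Fin (p k) → ℝ} {w : ℝ → (Fin d → ℝ) → Grid p → ℝ}

theorem rpow_div_pow {h : ℝ} (hh : 0 < h) (κ : ℝ) (S : ℕ) :
    h ^ κ / h ^ S = h ^ (κ - (S : ℝ)) := by
  rw [Real.rpow_sub hh, Real.rpow_natCast]

/-- The bias of the estimator. -/
theorem WeightCondition.abs_bias_le {α L : ℝ} (hα : 0 < α)
    (hw : WeightCondition s (strictFloor α) c h₀ C₁ C₂ p t w)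
    (hs : ∑ k, s k ≤ strictFloor α)
    (ht : RegularDesign Cd p t) (hp : 1 ≤ pMin p) (hc : 0 < c) (hC₁ : 0 < C₁) (hL : 0 < L)
    {h : ℝ} (hh : h ∈ Set.Ioc (c / (pMin p : ℝ)) h₀) {μ : (Fin d → ℝ) → ℝ}
    (hμ : HolderClass α L μ) {x : Fin d → ℝ} (hx : x ∈ unitCube d) :
    |weightSum t w h x μ - multiPartial s μ x| ≤
      windowConst d Cd c * C₁ * (d : ℝ) ^ strictFloor α * L *
        h ^ (α - ((∑ k, s k : ℕ) : ℝ)) := by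
  have hh0 : 0 < h := lt_of_le_of_lt (by positivity) hh.1
  have h1 := hw.abs_weightSum_sub_le ht hp hc hC₁ le_rfl hh
    (sub_pos.2 (strictFloor_isGreatest hα).1) (le_max_right _ _) (hμ.holderTop hα) hx
  rwa [if_pos hs, max_eq_left hL.le, add_sub_cancel, rpow_div_pow hh0] at h1

/-- Bounds for the linear functional on a rough Hölder class. -/
theorem WeightCondition.exists_rough_const (hd : 1 ≤ d) {β β₁ : ℝ} (hβ : 0 < β) (hβ₁ : β₁ < β)
    (hβs : β ≤ ((∑ k, s k : ℕ) : ℝ)) (hs : ∑ k, s k ≤ m) (hc : 0 < c) (hh₀ : 0 < h₀)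
    (hCd : 0 < Cd) (hC₁ : 0 < C₁) (hC₂ : 0 < C₂) :
    ∃ η K : ℝ, 0 < η ∧ η ≤ β - β₁ ∧ 0 < K ∧
      ∀ (p : Fin d → ℕ) (t : ∀ k : Fin d, Fin (p k) → ℝ) (w : ℝ → (Fin d → ℝ) → Grid p → ℝ),
        WeightCondition s m c h₀ C₁ C₂ p t w → RegularDesign Cd p t → 1 ≤ pMin p →
        ∀ h ∈ Set.Ioc (c / (pMin p : ℝ)) h₀, ∀ (f : (Fin d → ℝ) → ℝ) (M : ℝ),
          HolderClass β M f →
          (∀ x ∈ unitCube d, |∑ j, w h x j * f (designPoint t j)| ≤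
            K * h ^ (β - ((∑ k, s k : ℕ) : ℝ) - η) * max M 0) ∧
          ∀ x ∈ unitCube d, ∀ y ∈ unitCube d,
            |∑ j, w h x j * f (designPoint t j) - ∑ j, w h y j * f (designPoint t j)| ≤
              K * h ^ (β - ((∑ k, s k : ℕ) : ℝ) - η) * max M 0 * ‖x - y‖ ^ η := by
  have hwc := windowConst_pos (d := d) (c := c) hCd
  have hd' : (0 : ℝ) < d := by exact_mod_cast hd
  have hfl := (strictFloor_isGreatest hβ).1
  have hq : strictFloor β < ∑ k, s k := by exact_mod_cast lt_of_lt_of_le hfl hβs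
  set q := strictFloor β with hqdef
  set S := ∑ k, s k with hS
  set K := 2 * (windowConst d Cd c * C₁ * (d : ℝ) ^ q) +
      windowConst d Cd c * 2 ^ d * C₂ * (d : ℝ) ^ q * 2 ^ ((q : ℝ) + (β - q)) with hK
  have hK0 : 0 < K := by positivity
  -- Chaining at exponent `η` costs `h ^ (-η)`, which must fit into the gap `β - β₁`; the
  -- interpolation of increments requires `η ≤ 1`.
  set η := min (β - β₁) 1 with hη
  have hη0 : 0 < η := lt_min (by linarith) one_pos
  -- Chaining uses one constant for values and increments. The values lack the loss `h ^ (-η)`, and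
  -- `h ^ η ≤ h₀ ^ η` puts them in the same form.
  refine ⟨η, K * (1 + h₀ ^ η), hη0, min_le_left _ _, by positivity,
    fun p t w hw ht hp h hh f M hf => ?_⟩
  have hh0 : 0 < h := lt_of_le_of_lt (by positivity) hh.1
  obtain ⟨h1, h2⟩ := hw.rough_bounds ht hp hc hCd hC₁ hC₂ hs hq hh (sub_pos.2 hfl)
    (le_max_right M 0) hη0 (min_le_right _ _) (hf.holderTop hβ) hK
  rw [add_sub_cancel, rpow_div_pow hh0] at h1 h2
  have hhη : h ^ (β - (S : ℝ)) = h ^ (β - (S : ℝ) - η) * h ^ η := by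
    rw [← Real.rpow_add hh0]; congr 1; ring
  have hhη2 : h ^ η ≤ h₀ ^ η := Real.rpow_le_rpow hh0.le hh.2 hη0.le
  have hA : 0 ≤ K * h ^ (β - (S : ℝ) - η) * max M 0 :=
    mul_nonneg (by positivity) (le_max_right _ _)
  refine ⟨fun x hx => (h1 x hx).trans ?_, fun x hx y hy => (h2 x hx y hy).trans ?_⟩
  · rw [hhη]
    calc K * (h ^ (β - (S : ℝ) - η) * h ^ η) * max M 0
        = K * h ^ (β - (S : ℝ) - η) * max M 0 * h ^ η := by ring
      _ ≤ K * h ^ (β - (S : ℝ) - η) * max M 0 * (1 + h₀ ^ η) := by gcongr; linarith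
      _ = _ := by ring
  · rw [hhη, Real.div_rpow (norm_nonneg _) hh0.le]
    have h3 : h ^ η ≠ 0 := by positivity
    calc K * (h ^ (β - (S : ℝ) - η) * h ^ η) * max M 0 * (‖x - y‖ ^ η / h ^ η)
        = K * h ^ (β - (S : ℝ) - η) * max M 0 * 1 * ‖x - y‖ ^ η := by field_simp
      _ ≤ K * h ^ (β - (S : ℝ) - η) * max M 0 * (1 + h₀ ^ η) * ‖x - y‖ ^ η := by
        gcongr
        have : 0 < h₀ ^ η := by positivity
        linarith
      _ = _ := by ring

/-- Bounds for the linear functional on a smooth Hölder class. -/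
theorem WeightCondition.exists_smooth_const (hd : 1 ≤ d) {β : ℝ} (hβ : 0 < β)
    (hβs : ((∑ k, s k : ℕ) : ℝ) < β) (hs : ∑ k, s k ≤ m) (hc : 0 < c) (hh₀ : 0 < h₀)
    (hCd : 0 < Cd) (hC₁ : 0 < C₁) (hC₂ : 0 < C₂) :
    ∃ η K : ℝ, 0 < η ∧ 0 < K ∧
      ∀ (p : Fin d → ℕ) (t : ∀ k : Fin d, Fin (p k) → ℝ) (w : ℝ → (Fin d → ℝ) → Grid p → ℝ),
        WeightCondition s m c h₀ C₁ C₂ p t w → RegularDesign Cd p t → 1 ≤ pMin p →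
        ∀ h ∈ Set.Ioc (c / (pMin p : ℝ)) h₀, ∀ (f : (Fin d → ℝ) → ℝ) (M : ℝ),
          HolderClass β M f →
          (∀ x ∈ unitCube d, |∑ j, w h x j * f (designPoint t j)| ≤ K * max M 0) ∧
          ∀ x ∈ unitCube d, ∀ y ∈ unitCube d,
            |∑ j, w h x j * f (designPoint t j) - ∑ j, w h y j * f (designPoint t j)| ≤
              K * max M 0 * ‖x - y‖ ^ η := by
  have hwc := windowConst_pos (d := d) (c := c) hCd
  have hd' : (0 : ℝ) < d := by exact_mod_cast hd
  obtain ⟨γ, hγ0, hγ1, hγ⟩ := exists_holderTop_of_lt hd hβ hβs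
  set q := ∑ k, s k with hq
  set K := 1 + (2 + h₀ ^ γ) * (windowConst d Cd c * C₁ * (d : ℝ) ^ q) +
      windowConst d Cd c * 2 ^ d * C₂ * (d : ℝ) ^ q * 2 ^ ((q : ℝ) + γ) with hK
  have hK0 : 0 < K := by positivity
  refine ⟨γ, K * d, hγ0, by positivity, fun p t w hw ht hp h hh f M hf => ?_⟩
  have h1 := hw.smooth_bounds ht hp hc hCd hC₁ hC₂ hs hq hh hγ0
    (mul_nonneg hd'.le (le_max_right M 0)) hγ1 (hγ f M hf) (fun x hx =>
      (hf.abs_multiPartial_le ((strictFloor_isGreatest hβ).2 hβs) hx).trans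
        (le_mul_of_one_le_left (le_max_right _ _) (by exact_mod_cast hd))) hK
  rw [← mul_assoc] at h1
  exact h1

end Rates

/-! ### Balancing the three contributions. -/

theorem corollary1 (d : ℕ) (hd : 1 ≤ d)
    (α β L CZ : ℝ) (hα : 0 < α) (hβ : 0 < β) (hL : 0 < L) (hCZ : 0 < CZ)
    (s : Fin d → ℕ) (hs : ∑ k, s k ≤ strictFloor α)
    (Cd : ℝ) (hCd : 0 < Cd) (σ ζ : ℝ) (hσ : 0 ≤ σ) (hζ : 0 < ζ)
    (c h₀ C₁ C₂ : ℝ) (hc : 0 < c) (hh₀ : 0 < h₀) (hC₁ : 0 < C₁) (hC₂ : 0 < C₂)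
    (a b : ℝ) (ha : 0 < a) (hab : a ≤ b) :
    -- rough processes
    (β ≤ ((∑ k, s k : ℕ) : ℝ) → ∀ β₁ : ℝ, 0 < β₁ → β₁ < β →
      ∃ C : ℝ, 0 < C ∧ ∃ n₀ p₀ : ℕ, ∀ n : ℕ, n₀ ≤ n → ∀ p : Fin d → ℕ, p₀ ≤ pMin p →
        ∀ (t : ∀ k : Fin d, Fin (p k) → ℝ) (w : ℝ → (Fin d → ℝ) → Grid p → ℝ),
          RegularDesign Cd p t →
          WeightCondition s (strictFloor α) c h₀ C₁ C₂ p t w →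
          ∀ h ∈ Set.Ioc (c / (pMin p : ℝ)) h₀,
            h ∈ Set.Icc
              (a * max (1 / (pMin p : ℝ)) (max (noiseLevel n p ^ (1 / (2 * α + d)))
                ((n : ℝ) ^ (-(1 / (2 * (α - β₁)))))))
              (b * max (1 / (pMin p : ℝ)) (max (noiseLevel n p ^ (1 / (2 * α + d)))
                ((n : ℝ) ^ (-(1 / (2 * (α - β₁))))))) →
            ∀ (Ω : Type*) [MeasurableSpace Ω] (P : Measure Ω) [IsProbabilityMeasure P]
              (μ : (Fin d → ℝ) → ℝ) (Z : Fin n → (Fin d → ℝ) → Ω → ℝ)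
              (ε : Fin n → Grid p → Ω → ℝ),
              HolderClass α L μ → FunctionalDataModel P β CZ σ ζ n p Z ε →
              supRisk P s t w h μ Z ε ≤ ENNReal.ofReal (C *
                max ((pMin p : ℝ) ^ (-(α - ((∑ k, s k : ℕ) : ℝ))))
                  (max (noiseLevel n p ^ ((α - ((∑ k, s k : ℕ) : ℝ)) / (2 * α + d)))
                    ((n : ℝ) ^ (-((α - ((∑ k, s k : ℕ) : ℝ)) / (2 * (α - β₁)))))))) ∧
    -- smooth processes
    (((∑ k, s k : ℕ) : ℝ) < β →
      ∃ C : ℝ, 0 < C ∧ ∃ n₀ p₀ : ℕ, ∀ n : ℕ, n₀ ≤ n → ∀ p : Fin d → ℕ, p₀ ≤ pMin p →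
        ∀ (t : ∀ k : Fin d, Fin (p k) → ℝ) (w : ℝ → (Fin d → ℝ) → Grid p → ℝ),
          RegularDesign Cd p t →
          WeightCondition s (strictFloor α) c h₀ C₁ C₂ p t w →
          ∀ h ∈ Set.Ioc (c / (pMin p : ℝ)) h₀,
            h ∈ Set.Icc
              (a * max (1 / (pMin p : ℝ)) (noiseLevel n p ^ (1 / (2 * α + d))))
              (b * max (1 / (pMin p : ℝ)) (noiseLevel n p ^ (1 / (2 * α + d)))) →
            ∀ (Ω : Type*) [MeasurableSpace Ω] (P : Measure Ω) [IsProbabilityMeasure P]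
              (μ : (Fin d → ℝ) → ℝ) (Z : Fin n → (Fin d → ℝ) → Ω → ℝ)
              (ε : Fin n → Grid p → Ω → ℝ),
              HolderClass α L μ → FunctionalDataModel P β CZ σ ζ n p Z ε →
              supRisk P s t w h μ Z ε ≤ ENNReal.ofReal (C *
                max ((pMin p : ℝ) ^ (-(α - ((∑ k, s k : ℕ) : ℝ))))
                  (max (noiseLevel n p ^ ((α - ((∑ k, s k : ℕ) : ℝ)) / (2 * α + d)))
                    ((n : ℝ) ^ (-(1 / 2 : ℝ)))))) := by
  set S := ∑ k, s k with hS
  have hSα : (S : ℝ) < α :=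
    lt_of_le_of_lt (by exact_mod_cast hs) (strictFloor_isGreatest hα).1
  set θ := α - (S : ℝ) with hθ
  have hθ0 : 0 < θ := sub_pos.2 hSα
  have hb : 0 < b := ha.trans_le hab
  have hwc := windowConst_pos (d := d) (c := c) hCd
  set Kb := windowConst d Cd c * C₁ * (d : ℝ) ^ strictFloor α * L with hKb
  have hKb0 : 0 ≤ Kb := by positivity
  set Ke := errorConst d α Cd σ ζ c h₀ C₁ C₂ a with hKe
  have hKe0 : 0 ≤ Ke := by unfold Ke errorConst; positivity
  have hαd : 0 < 2 * α + (d : ℝ) := by positivity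
  have hpn : ∀ p : Fin d → ℕ, (1 / (pMin p : ℝ)) ^ θ = (pMin p : ℝ) ^ (-θ) := fun p => by
    rw [one_div, Real.inv_rpow (Nat.cast_nonneg _), Real.rpow_neg (Nat.cast_nonneg _)]
  have hrn : ∀ r : ℝ, 0 ≤ r → (r ^ (1 / (2 * α + d))) ^ θ = r ^ (θ / (2 * α + d)) :=
    fun r hr => by
      rw [← Real.rpow_mul hr]; congr 1; ring
  constructor
  · intro hβs β₁ hβ₁ hβ₁β
    -- Here `β₁ < β ≤ S < α`.
    have hαβ : 0 < α - β₁ := by linarith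
    obtain ⟨η, K, hη, hηβ, hK, hproc⟩ := WeightCondition.exists_rough_const (m := strictFloor α)
      hd hβ hβ₁β hβs hs hc hh₀ hCd hC₁ hC₂
    set Kp := chainConst d η * K * √CZ * (h₀ ^ (β - η - β₁) / a ^ (α - β₁)) with hKp
    have hKp0 : 0 < Kp := by
      have := chainConst_pos (d := d) (γ := η)
      have := Real.sqrt_pos.2 hCZ
      positivity
    -- All three terms are multiples of `h ^ θ`, and the upper bound on `h` contributes `b ^ θ`. The
    -- threshold `n ≥ 2` keeps `log (n p^1)` away from zero.
    refine ⟨(Kb + Kp + Ke) * b ^ θ, by positivity, 2, 1, ?_⟩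
    intro n hn p hp t w ht hw h hh hab Ω _ P _ μ Z ε hμ hmod
    have hh0 : 0 < h := lt_of_le_of_lt (by positivity) hh.1
    have hn' : (0 : ℝ) < n := by exact_mod_cast (by omega : 0 < n)
    have hr0 := noiseLevel_nonneg (p := p) (by omega : 1 ≤ n) hp
    have hproc' := hmod.exists_process_bound (by omega) hCZ ht
      (B := K * h ^ (β - (S : ℝ) - η)) (by positivity) hη (w h) (hproc p t w hw ht hp h hh)
    have herr := hmod.exists_error_bound hn hw hd ht hp hc hCd hC₂ hh hα ha
      (le_trans (by gcongr; exact (le_max_left _ _).trans (le_max_right _ _)) hab.1)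
    refine (supRisk_le (by omega)
      (fun x hx => hw.abs_bias_le hα hs ht hp hc hC₁ hL hh hμ hx) hproc' herr).trans
      (ENNReal.ofReal_le_ofReal ?_)
    have h1 : h ^ θ ≤ b ^ θ * max ((pMin p : ℝ) ^ (-θ))
        (max (noiseLevel n p ^ (θ / (2 * α + d))) ((n : ℝ) ^ (-(θ / (2 * (α - β₁)))))) := by
      have h2 : ((n : ℝ) ^ (-(1 / (2 * (α - β₁))))) ^ θ = (n : ℝ) ^ (-(θ / (2 * (α - β₁)))) := by
        rw [← Real.rpow_mul hn'.le]; congr 1; ring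
      rw [← hpn, ← hrn _ hr0, ← h2, ← max_rpow_of_nonneg (by positivity) (by positivity) hθ0.le,
        ← max_rpow_of_nonneg (by positivity) (by positivity) hθ0.le,
        ← Real.mul_rpow hb.le (by positivity)]
      exact Real.rpow_le_rpow hh0.le hab.2 hθ0.le
    -- The lower bound on `h` from the process term, raised to the power `α - β₁`, trades `n ^
    -- (-1/2)` for a power of the bandwidth.
    have h2 : 1 / √(n : ℝ) ≤ h ^ (α - β₁) / a ^ (α - β₁) := by
      have h3 : (n : ℝ) ^ (-(1 / (2 * (α - β₁)))) ≤ h / a := by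
        rw [le_div_iff₀ ha, mul_comm]
        refine le_trans ?_ hab.1
        gcongr
        exact (le_max_right _ _).trans (le_max_right _ _)
      have h4 := Real.rpow_le_rpow (by positivity) h3 hαβ.le
      rw [← Real.rpow_mul hn'.le, Real.div_rpow hh0.le ha.le] at h4
      refine le_trans (le_of_eq ?_) h4
      rw [Real.sqrt_eq_rpow, one_div, ← Real.rpow_neg hn'.le]
      congr 1
      field_simp
    have h3 : chainConst d η * (K * h ^ (β - (S : ℝ) - η)) * √CZ / √n ≤ Kp * h ^ θ := by
      -- The surplus exponent `β - η - β₁` is nonnegative by the choice of `η`, so it is absorbed by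
      -- `h₀`.
      have h4 : h ^ (β - (S : ℝ) - η) * h ^ (α - β₁) = h ^ (β - η - β₁) * h ^ θ := by
        rw [← Real.rpow_add hh0, ← Real.rpow_add hh0]; congr 1; rw [hθ]; ring
      have h5 : h ^ (β - η - β₁) ≤ h₀ ^ (β - η - β₁) :=
        Real.rpow_le_rpow hh0.le hh.2 (by linarith)
      have h6 := (chainConst_pos (d := d) (γ := η)).le
      calc chainConst d η * (K * h ^ (β - (S : ℝ) - η)) * √CZ / √n
          = chainConst d η * K * √CZ * h ^ (β - (S : ℝ) - η) * (1 / √n) := by ring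
        _ ≤ chainConst d η * K * √CZ * h ^ (β - (S : ℝ) - η) *
            (h ^ (α - β₁) / a ^ (α - β₁)) :=
          mul_le_mul_of_nonneg_left h2 (by positivity)
        _ = chainConst d η * K * √CZ *
            (h ^ (β - (S : ℝ) - η) * h ^ (α - β₁)) / a ^ (α - β₁) := by ring
        _ ≤ chainConst d η * K * √CZ *
            (h₀ ^ (β - η - β₁) * h ^ θ) / a ^ (α - β₁) := by
          rw [h4]; gcongr
        _ = _ := by rw [hKp]; ring
    calc _ ≤ Kb * h ^ θ + Kp * h ^ θ + Ke * h ^ θ := by gcongr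
      _ = (Kb + Kp + Ke) * h ^ θ := by ring
      _ ≤ (Kb + Kp + Ke) * (b ^ θ * _) := by gcongr
      _ = _ := by ring
  · intro hβs
    obtain ⟨η, K, hη, hK, hproc⟩ := WeightCondition.exists_smooth_const (m := strictFloor α)
      hd hβ hβs hs hc hh₀ hCd hC₁ hC₂
    set Kp := chainConst d η * K * √CZ with hKp
    have hKp0 : 0 < Kp := by
      have := chainConst_pos (d := d) (γ := η)
      have := Real.sqrt_pos.2 hCZ
      positivity
    -- The process term is of order `n ^ (-1/2)` whatever the bandwidth, so it carries no factor `b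
    -- ^ θ`.
    refine ⟨(Kb + Ke) * b ^ θ + Kp, by positivity, 2, 1, ?_⟩
    intro n hn p hp t w ht hw h hh hab Ω _ P _ μ Z ε hμ hmod
    have hh0 : 0 < h := lt_of_le_of_lt (by positivity) hh.1
    have hn' : (0 : ℝ) < n := by exact_mod_cast (by omega : 0 < n)
    have hr0 := noiseLevel_nonneg (p := p) (by omega : 1 ≤ n) hp
    have hproc' := hmod.exists_process_bound (by omega) hCZ ht hK hη (w h)
      (hproc p t w hw ht hp h hh)
    have herr := hmod.exists_error_bound hn hw hd ht hp hc hCd hC₂ hh hα ha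
      (le_trans (by gcongr; exact le_max_right _ _) hab.1)
    refine (supRisk_le (by omega)
      (fun x hx => hw.abs_bias_le hα hs ht hp hc hC₁ hL hh hμ hx) hproc' herr).trans
      (ENNReal.ofReal_le_ofReal ?_)
    set R := max ((pMin p : ℝ) ^ (-θ)) (max (noiseLevel n p ^ (θ / (2 * α + d)))
      ((n : ℝ) ^ (-(1 / 2 : ℝ)))) with hR
    have h1 : h ^ θ ≤ b ^ θ * R := by
      have h2 : h ^ θ ≤ b ^ θ * max ((pMin p : ℝ) ^ (-θ)) (noiseLevel n p ^ (θ / (2 * α + d))) := by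
        rw [← hpn, ← hrn _ hr0, ← max_rpow_of_nonneg (by positivity) (by positivity) hθ0.le,
          ← Real.mul_rpow hb.le (by positivity)]
        exact Real.rpow_le_rpow hh0.le hab.2 hθ0.le
      refine h2.trans ?_
      gcongr
      exact max_le_max le_rfl (le_max_left _ _)
    have h2 : 1 / √(n : ℝ) ≤ R := by
      rw [Real.sqrt_eq_rpow, one_div, ← Real.rpow_neg hn'.le]
      exact (le_max_right _ _).trans (le_max_right _ _)
    calc _ = (Kb + Ke) * h ^ θ + Kp * (1 / √n) := by rw [hKp]; ring
      _ ≤ (Kb + Ke) * (b ^ θ * R) + Kp * R := by gcongr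
      _ = _ := by ring
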